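/- A poset $P$ is *reversible* if every order preserving bijection $P\to P$ is an automorphism of $P$, and *hereditarily reversible* if every subset of $P$, with the induced order, is reversible. Write $\sqcup$ for disjoint union, $\oplus$ for linear sum (in $A\oplus B$ every element of $A$ lies below every element of $B$), $P^d$ for the dual of $P$, $\omega$ for the least infinite ordinal, $D_\infty$ for the countably infinite antichain, $D_n$ for the $n$-element antichain. Let $$F_1=D_\infty\sqcup\omega,\quad F_2=(D_1\oplus D_\infty)\sqcup D_\infty,\quad F_3=D_\infty\sqcup\bigsqcup_{i=0}^{\infty}(D_1\oplus D_1),\quad F_4=D_\infty\oplus\omega,\quad F_5=(D_1\sqcup\omega^d)\oplus\omega,$$ $$F_6=(\cdots\oplus D_2\oplus D_2\oplus D_2)\oplus\omega;$$ let $F_7$ consist of a chain $c_0<c_1<c_2<\cdots$ and an antichain $\{d_0,d_1,d_2,\dots\}$ (all these elements being distinct), where $d_i<c_j$ if and only if $i<j$, and never $c_j< d_i$; and let $F_8$ consist of distinct elements $a_i,b_i$ ($i\in\mathbb Z$), where $a_i<b_j$ if and only if $i>0$ or $j\neq i$, and there are no other strict relations. Let $P$ be a poset. Then $P$ is hereditarily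 reversible if and only if no subset of $P$ is isomorphic to any of the posets $F_i$ or $F_i^d$, $i=1,\dots,8$. Moreover, none of the posets $F_i$, $F_i^d$ is reversible; $F_3$ and $F_8$ are self-dual, and the posets $F_i$, $F_i^d$, $i=1,\dots,8$, form exactly $14$ isomorphism classes. -/

import Mathlib

namespace RevPoset

/-- A poset is reversible if every order preserving bijective self map is an automorphism. -/
def Reversible (P : Type*) [PartialOrder P] : Prop :=
  ∀ f : P → P, Monotone f → Function.Bijective f → ∃ e : P ≃o P, ⇑e = f

/-- Every subset, with the induced order, is reversible. -/
def HereditarilyReversible (P : Type*) [PartialOrder P] : Prop :=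
  ∀ S : Set P, Reversible S

/-- Some subset of `P`, with the induced order, is isomorphic to `Q`. -/
def HasSubsetIso (P Q : Type*) [PartialOrder P] [PartialOrder Q] : Prop :=
  ∃ S : Set P, Nonempty (S ≃o Q)

/-- The antichain on the underlying set `α`. -/
structure Antichain (α : Type) where
  val : α

instance (α : Type) : PartialOrder (Antichain α) where
  le x y := x = y
  le_refl _ := rfl
  le_trans _ _ _ h h' := h.trans h'
  le_antisymm _ _ h _ := h

/-- The countably infinite antichain. -/
abbrev DInf : Type := Antichain ℕ

/-- The two-element antichain. -/
abbrev D2 : Type := Antichain Bool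

/-- The one-element poset. -/
abbrev D1 : Type := Unit

/-!
`α ⊕ β` and `Σ i, α i` carry the order of the disjoint union, `α ⊕ₗ β` is the linear sum
(all of `α` below all of `β`), `α ×ₗ β` is the lexicographic product, `αᵒᵈ` is the dual,
and `ℕ` with its usual order is `ω`.
-/

abbrev F1 : Type := DInf ⊕ ℕ

abbrev F2 : Type := (D1 ⊕ₗ DInf) ⊕ DInf

abbrev F3 : Type := DInf ⊕ (Σ _ : ℕ, (D1 ⊕ₗ D1))

abbrev F4 : Type := DInf ⊕ₗ ℕ

abbrev F5 : Type := (D1 ⊕ ℕᵒᵈ) ⊕ₗ ℕ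

/-- A chain `ω` on top of a descending sequence of two-element antichains, each of which lies
entirely above the next one. -/
abbrev F6 : Type := (ℕᵒᵈ ×ₗ D2) ⊕ₗ ℕ

/-- A chain `c 0 < c 1 < ⋯` and an antichain `d 0, d 1, …`, where `d i` is covered by
`c (i + 1)`; so `d i < c j` exactly if `i < j`. -/
inductive F7 : Type
  | c (i : ℕ)
  | d (i : ℕ)

/-- The order relation of `F7`. -/
def F7.Le : F7 → F7 → Prop
  | .c i, .c j => i ≤ j
  | .d i, .d j => i = j
  | .d i, .c j => i < j
  | .c _, .d _ => False

instance : PartialOrder F7 where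
  le := F7.Le
  le_refl x := by cases x <;> simp [F7.Le]
  le_trans x y z h h' := by
    cases x <;> cases y <;> cases z <;> simp only [F7.Le] at * <;> omega
  le_antisymm x y h h' := by
    cases x <;> cases y <;> simp only [F7.Le, F7.c.injEq, F7.d.injEq] at * <;> omega

/-- Elements `a i`, `b i` for `i : ℤ`, where `a i < b j` exactly if `i > 0` or `j ≠ i`, and there
are no other strict relations. -/
inductive F8 : Type
  | a (i : ℤ)
  | b (i : ℤ)

/-- The order relation of `F8`. -/
def F8.Le : F8 → F8 → Prop
  | .a i, .a j => i = j
  | .b i, .b j => i = j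
  | .a i, .b j => 0 < i ∨ j ≠ i
  | .b _, .a _ => False

instance : PartialOrder F8 where
  le := F8.Le
  le_refl x := by cases x <;> simp [F8.Le]
  le_trans x y z h h' := by
    cases x <;> cases y <;> cases z <;> simp only [F8.Le] at * <;> omega
  le_antisymm x y h h' := by
    cases x <;> cases y <;> simp only [F8.Le, F8.a.injEq, F8.b.injEq] at * <;> omega

/-- The list of the eight posets `F1, …, F8` (indexed from `0`). -/
def F : Fin 8 → PartOrd.{0}
  | 0 => PartOrd.of F1
  | 1 => PartOrd.of F2
  | 2 => PartOrd.of F3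
  | 3 => PartOrd.of F4
  | 4 => PartOrd.of F5
  | 5 => PartOrd.of F6
  | 6 => PartOrd.of F7
  | 7 => PartOrd.of F8

/-- The eight posets (second index `false`) and their duals (second index `true`). -/
def forbidden : Fin 8 × Bool → PartOrd.{0}
  | (i, false) => F i
  | (i, true) => PartOrd.of (F i)ᵒᵈ

/-- Two indices are equivalent if the posets they denote are isomorphic. -/
def isoSetoid : Setoid (Fin 8 × Bool) where
  r p q := Nonempty (forbidden p ≃o forbidden q)
  iseqv :=
    { refl := fun _ => ⟨OrderIso.refl _⟩
      symm := fun ⟨e⟩ => ⟨e.symm⟩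
      trans := fun ⟨e⟩ ⟨e'⟩ => ⟨e.trans e'⟩ }

end RevPoset

open RevPoset

namespace RevPoset

/-! If a poset is not reversible, it has a monotone permutation `e` and points with `x ≰ y` but `e x
≤ e y`. Relations persist forward along orbits, so `e^n x ≤ e^n y` holds for every `n ≥ 1` and fails
for every `n ≤ 0`: a new relation appears at one moment. The forbidden posets are extracted from the
two halves of the orbits, before and after that moment.

If `x` and `y` are both periodic, a power of `e` fixes both, which is absurd. An infinite orbit that
gains a relation within itself already contains a forbidden poset (`contains_of_orbit`). Otherwise
the shift is an automorphism of each infinite orbit, so along multiples of some `d` the orbit is an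
antichain, an increasing chain or a decreasing chain (`antichain_or_chain`). What remains is a fixed
point against such an orbit (`contains_of_fixed_orbit`), or two such orbits with nine combinations
of types (`OrbitPair.contains`). Each is settled by thinning sequences, with duality sparing some
cases.

Conversely, each forbidden poset has an explicit monotone permutation that gains a relation, and
reversibility passes along isomorphisms and duals. For the count, invariants insensitive to duality
separate the eight posets, and only `F3` and `F8` are self-dual, so there are 2 · 8 − 2 classes. -/

/-- One of the forbidden posets or their duals embeds into `P`. -/
def ContainsForbidden (P : Type*) [PartialOrder P] : Prop :=
  ∃ i : Fin 8, Nonempty (F i ↪o P) ∨ Nonempty ((F i)ᵒᵈ ↪o P)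

theorem hasSubsetIso_iff {P Q : Type*} [PartialOrder P] [PartialOrder Q] :
    HasSubsetIso P Q ↔ Nonempty (Q ↪o P) := by
  constructor
  · rintro ⟨S, ⟨e⟩⟩
    exact ⟨e.symm.toOrderEmbedding.trans (OrderEmbedding.subtype _)⟩
  · rintro ⟨e⟩
    exact ⟨Set.range e, ⟨(OrderEmbedding.orderIso (f := e)).symm⟩⟩

theorem Antichain.forall {α : Type} {p : Antichain α → Prop} :
    (∀ x, p x) ↔ ∀ a, p ⟨a⟩ :=
  ⟨fun h a => h ⟨a⟩, fun h x => h x.val⟩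

@[simp] theorem Antichain.mk_le_mk {α : Type} {x y : α} :
    (⟨x⟩ : Antichain α) ≤ ⟨y⟩ ↔ x = y :=
  ⟨fun h => congrArg Antichain.val h, fun h => congrArg Antichain.mk h⟩

@[simp] theorem Antichain.not_lt {α : Type} {x y : Antichain α} : ¬ x < y :=
  fun h => h.ne h.le

theorem sigma_const_le {ι α : Type*} [LE α] {i j : ι} {a b : α} :
    (⟨i, a⟩ : Σ _ : ι, α) ≤ ⟨j, b⟩ ↔ i = j ∧ a ≤ b := by
  constructor
  · rintro ⟨⟩
    exact ⟨rfl, ‹_›⟩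
  · rintro ⟨rfl, h⟩
    exact .fiber _ _ _ h

/-! ### Recognizing the forbidden posets from sequences -/

section Containment

variable {P : Type*} [PartialOrder P]

theorem ContainsForbidden.of_embedding {Q : Type*} [PartialOrder Q] (e : Q ↪o P)
    (h : ContainsForbidden Q) : ContainsForbidden P := by
  obtain ⟨i, ⟨⟨g⟩⟩ | ⟨⟨g⟩⟩⟩ := h
  · exact ⟨i, .inl ⟨g.trans e⟩⟩
  · exact ⟨i, .inr ⟨g.trans e⟩⟩

theorem ContainsForbidden.of_dual (h : ContainsForbidden Pᵒᵈ) : ContainsForbidden P := by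
  obtain ⟨i, ⟨⟨g⟩⟩ | ⟨⟨g⟩⟩⟩ := h
  · exact ⟨i, .inr ⟨g.dual.trans (OrderIso.dualDual P).symm.toOrderEmbedding⟩⟩
  · exact ⟨i, .inl ⟨(OrderIso.dualDual _).toOrderEmbedding.trans
      (g.dual.trans (OrderIso.dualDual P).symm.toOrderEmbedding)⟩⟩

theorem contains_F1 {a c : ℕ → P} (ha : ∀ i j, a i ≤ a j → i = j) (hc : StrictMono c)
    (hac : ∀ i j, ¬ a i ≤ c j) (hca : ∀ i j, ¬ c j ≤ a i) : ContainsForbidden P := by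
  refine ⟨0, .inl ⟨(OrderEmbedding.ofMapLEIff (α := F1)
    (Sum.elim (fun x => a x.val) c) ?_ : F1 ↪o P)⟩⟩
  have ha' : ∀ i j, a i ≤ a j ↔ i = j := fun i j => ⟨ha i j, fun h => h ▸ le_rfl⟩
  simp [Antichain.forall, ha', hac, hca, hc.le_iff_le]

theorem contains_F2 {p : P} {a b : ℕ → P} (ha : ∀ i j, a i ≤ a j → i = j)
    (hb : ∀ i j, b i ≤ b j → i = j) (hpa : ∀ i, p < a i) (hpb : ∀ i, ¬ p ≤ b i)
    (hbp : ∀ i, ¬ b i ≤ p) (hab : ∀ i j, ¬ a i ≤ b j) (hba : ∀ i j, ¬ b i ≤ a j) :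
    ContainsForbidden P := by
  refine ⟨1, .inl ⟨(OrderEmbedding.ofMapLEIff (α := F2)
    (Sum.elim (fun x => Sum.elim (fun _ => p) (fun x => a x.val) (ofLex x)) (fun x => b x.val)) ?_ :
      F2 ↪o P)⟩⟩
  have ha' : ∀ i j, a i ≤ a j ↔ i = j := fun i j => ⟨ha i j, fun h => h ▸ le_rfl⟩
  have hb' : ∀ i j, b i ≤ b j ↔ i = j := fun i j => ⟨hb i j, fun h => h ▸ le_rfl⟩
  have hpa' : ∀ i, p ≤ a i := fun i => (hpa i).le
  have hap : ∀ i, ¬ a i ≤ p := fun i => (hpa i).not_ge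
  simp [Antichain.forall, ha', hb', hpa', hap, hpb, hbp, hab, hba]

/-- An infinite induced matching contains `F3`. -/
theorem contains_F3 {x y : ℕ → P} (hx : ∀ i j, x i ≤ x j → i = j)
    (hy : ∀ i j, y i ≤ y j → i = j) (hxy : ∀ i j, x i ≤ y j ↔ i = j)
    (hyx : ∀ i j, ¬ y i ≤ x j) : ContainsForbidden P := by
  -- Even indices keep both matched points; odd indices keep only the lower one, which becomes
  -- isolated.
  refine ⟨2, .inl ⟨(OrderEmbedding.ofMapLEIff (α := F3)
    (Sum.elim (fun i => x (2 * i.val + 1))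
      (fun s => Sum.elim (fun _ => x (2 * s.1)) (fun _ => y (2 * s.1)) (ofLex s.2))) ?_ :
      F3 ↪o P)⟩⟩
  have hx' : ∀ i j, x i ≤ x j ↔ i = j := fun i j => ⟨hx i j, fun h => h ▸ le_rfl⟩
  have hy' : ∀ i j, y i ≤ y j ↔ i = j := fun i j => ⟨hy i j, fun h => h ▸ le_rfl⟩
  simp [Antichain.forall, Sigma.forall, sigma_const_le, hx', hy', hxy, hyx]
  exact ⟨fun i j => by omega, fun i j => by omega⟩

theorem contains_F4 {a c : ℕ → P} (ha : ∀ i j, a i ≤ a j → i = j) (hc : StrictMono c)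
    (hac : ∀ i j, a i < c j) : ContainsForbidden P := by
  refine ⟨3, .inl ⟨(OrderEmbedding.ofMapLEIff (α := F4)
    (fun x => Sum.elim (fun x => a x.val) c (ofLex x)) ?_ : F4 ↪o P)⟩⟩
  have ha' : ∀ i j, a i ≤ a j ↔ i = j := fun i j => ⟨ha i j, fun h => h ▸ le_rfl⟩
  have h1 : ∀ i j, a i ≤ c j := fun i j => (hac i j).le
  have h2 : ∀ i j, ¬ c j ≤ a i := fun i j => (hac i j).not_ge
  simp [Antichain.forall, ha', h1, h2, hc.le_iff_le]

theorem contains_F5 {p : P} {d c : ℕ → P} (hd : StrictAnti d) (hc : StrictMono c)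
    (hpd : ∀ i, ¬ p ≤ d i) (hdp : ∀ i, ¬ d i ≤ p) (hpc : p < c 0) (hdc : d 0 < c 0) :
    ContainsForbidden P := by
  refine ⟨4, .inl ⟨(OrderEmbedding.ofMapLEIff (α := F5)
    (fun x => Sum.elim (Sum.elim (fun _ => p) (fun i => d (OrderDual.ofDual i))) c (ofLex x)) ?_ :
      F5 ↪o P)⟩⟩
  have h1 : ∀ j, p < c j := fun j => hpc.trans_le (hc.monotone (Nat.zero_le j))
  have h2 : ∀ i j, d i < c j := fun i j =>
    (hd.antitone (Nat.zero_le i)).trans_lt (hdc.trans_le (hc.monotone (Nat.zero_le j)))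
  have h3 : ∀ j, ¬ c j ≤ p := fun j => (h1 j).not_ge
  have h4 : ∀ i j, ¬ c j ≤ d i := fun i j => (h2 i j).not_ge
  simp [OrderDual.forall, hpd, hdp, fun j => (h1 j).le, fun i j => (h2 i j).le,
    h3, h4, hc.le_iff_le, hd.le_iff_ge]

theorem contains_F6 {u v c : ℕ → P} (huv : ∀ i, ¬ u i ≤ v i) (hvu : ∀ i, ¬ v i ≤ u i)
    (hu : ∀ i j, i < j → u j < u i ∧ u j < v i) (hv : ∀ i j, i < j → v j < u i ∧ v j < v i)
    (hc : StrictMono c) (huc : u 0 < c 0) (hvc : v 0 < c 0) : ContainsForbidden P := by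
  let w : Bool → ℕ → P := fun b => if b then u else v
  have hw : ∀ i j b b', i < j → w b' j < w b i := by
    intro i j b b' hij
    cases b <;> cases b' <;> simp [w, hu i j hij, hv i j hij]
  have hw0 : ∀ i b b', w b i ≤ w b' i ↔ b = b' := by
    intro i b b'
    cases b <;> cases b' <;> simp [w, huv, hvu]
  have h1 : ∀ i b j, w b i < c j := by
    intro i b j
    refine lt_of_lt_of_le ?_ (hc.monotone (Nat.zero_le j))
    have h0 : ∀ b, w b 0 < c 0 := fun b => by cases b <;> simpa [w]
    rcases Nat.eq_zero_or_pos i with rfl | hi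
    · exact h0 b
    · exact (hw 0 i b b hi).trans (h0 b)
  refine ⟨5, .inl ⟨(OrderEmbedding.ofMapLEIff (α := F6)
    (fun x => Sum.elim (fun z => w (ofLex z).2.val (OrderDual.ofDual (ofLex z).1)) c (ofLex x)) ?_ :
      F6 ↪o P)⟩⟩
  have h2 : ∀ i b j, ¬ c j ≤ w b i := fun i b j => (h1 i b j).not_ge
  have h3 : ∀ i b i' b', w b i ≤ w b' i' ↔ i' < i ∨ i = i' ∧ b = b' := by
    intro i b i' b'
    rcases lt_trichotomy i i' with h | rfl | h
    · simp [(hw i i' b b' h).not_ge, h.ne, h.not_gt]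
    · simp [hw0]
    · simp [(hw i' i b' b h).le, h]
  simp [OrderDual.forall, Antichain.forall, Prod.Lex.toLex_le_toLex,
    fun i b j => (h1 i b j).le, h2, h3, hc.le_iff_le]

theorem contains_F7 {a c : ℕ → P} (ha : ∀ i j, a i ≤ a j → i = j) (hc : StrictMono c)
    (hac : ∀ i j, a i ≤ c j ↔ i < j) (hca : ∀ i j, ¬ c j ≤ a i) : ContainsForbidden P := by
  refine ⟨6, .inl ⟨(OrderEmbedding.ofMapLEIff (α := F7)
    (fun x => F7.casesOn x c a) ?_ : F7 ↪o P)⟩⟩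
  have ha' : ∀ i j, a i ≤ a j ↔ i = j := fun i j => ⟨ha i j, fun h => h ▸ le_rfl⟩
  rintro (i | i) (j | j)
  · exact hc.le_iff_le
  · exact iff_of_false (hca _ _) id
  · exact hac i j
  · exact ha' i j

/-- The complement of an infinite matching contains `F8`. -/
theorem contains_F8 {x y : ℕ → P} (hx : ∀ i j, x i ≤ x j → i = j)
    (hy : ∀ i j, y i ≤ y j → i = j) (hxy : ∀ i j, x i ≤ y j ↔ i ≠ j)
    (hyx : ∀ i j, ¬ y i ≤ x j) : ContainsForbidden P := by
  have hx' : ∀ i j, x i ≤ x j ↔ i = j := fun i j => ⟨hx i j, fun h => h ▸ le_rfl⟩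
  have hy' : ∀ i j, y i ≤ y j ↔ i = j := fun i j => ⟨hy i j, fun h => h ▸ le_rfl⟩
  -- For `i ≤ 0` both points use the same even index, so the missing relation survives. For `i > 0`
  -- the indices are 1 and 3 modulo 4, so an `a i` never meets its non-neighbour.
  refine ⟨7, .inl ⟨(OrderEmbedding.ofMapLEIff (α := F8)
    (fun z => F8.casesOn z
      (fun i => x (if 0 < i then 4 * i.natAbs + 1 else 2 * i.natAbs))
      (fun i => y (if 0 < i then 4 * i.natAbs + 3 else 2 * i.natAbs))) ?_ : F8 ↪o P)⟩⟩
  rintro (i | i) (j | j)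
  · refine (hx' _ _).trans (Iff.trans ?_ (show i = j ↔ F8.a i ≤ F8.a j from Iff.rfl))
    split_ifs <;> omega
  · refine (hxy _ _).trans (Iff.trans ?_ (show (0 < i ∨ j ≠ i) ↔ F8.a i ≤ F8.b j from Iff.rfl))
    split_ifs <;> omega
  · exact iff_of_false (hyx _ _) id
  · refine (hy' _ _).trans (Iff.trans ?_ (show i = j ↔ F8.b i ≤ F8.b j from Iff.rfl))
    split_ifs <;> omega

end Containment

/-! ### A single infinite orbit, alone or with a fixed point -/

open Filter

section Orbits

variable {P : Type*} [PartialOrder P]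

/-- Greedy choice: each new index is taken large enough for all the finitely many earlier ones. This
is the thinning device used throughout. -/
theorem exists_strictMono_of_eventually {R : ℕ → ℕ → Prop} (h : ∀ i, ∀ᶠ k in atTop, R i k) :
    ∃ φ : ℕ → ℕ, StrictMono φ ∧ ∀ i k, i < k → R (φ i) (φ k) := by
  obtain ⟨φ, -, hφ⟩ := exists_seq_of_forall_finset_exists (fun _ : ℕ => True)
    (fun i k => i < k ∧ R i k) (fun s _ => by
      have : ∀ᶠ k in atTop, ∀ i ∈ s, i < k ∧ R i k :=
        (Finset.eventually_all s).2 fun i _ => (eventually_gt_atTop i).and (h i)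
      obtain ⟨k, hk⟩ := this.exists
      exact ⟨k, trivial, hk⟩)
  exact ⟨φ, fun i k hik => (hφ i k hik).1, fun i k hik => (hφ i k hik).2⟩

/-- An infinite antichain together with an increasing sequence, no term of which lies below an
element of the antichain, yields `F1`, `F4` or `F7`. -/
theorem contains_of_antichain_chain {a c : ℕ → P} (ha : ∀ i j, a i ≤ a j → i = j)
    (hc : StrictMono c) (hca : ∀ i j, ¬ c j ≤ a i) : ContainsForbidden P := by
  by_cases h1 : ∃ᶠ i in atTop, ∀ j, ¬ a i ≤ c j
  · obtain ⟨φ, hφ, h⟩ := extraction_of_frequently_atTop h1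
    exact contains_F1 (fun i j hij => hφ.injective (ha _ _ hij)) hc (fun i j => h i j)
      (fun i j => hca _ j)
  by_cases h2 : ∃ j, ∃ᶠ i in atTop, a i ≤ c j
  · obtain ⟨j, h2⟩ := h2
    obtain ⟨φ, hφ, h⟩ := extraction_of_frequently_atTop h2
    refine contains_F4 (c := fun k => c (j + k)) (fun i j hij => hφ.injective (ha _ _ hij))
      (fun i k hik => hc (by omega)) (fun i k => ?_)
    exact ((h i).trans (hc.monotone (Nat.le_add_right j k))).lt_of_not_ge (hca _ _)
  simp only [not_frequently, not_forall, not_not, not_exists] at h1 h2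
  obtain ⟨φ, hφ, h⟩ := extraction_of_eventually_atTop h1
  choose J hJ using h
  -- Now almost every antichain point lies below some `c (J i)`, while each `c j` is above only
  -- finitely many. Thinning makes later points escape earlier bounds, which forces `J ∘ ψ` to
  -- increase.
  obtain ⟨ψ, hψ, hR⟩ := exists_strictMono_of_eventually
    (R := fun i k => ¬ a (φ k) ≤ c (J i)) (fun i => hφ.tendsto_atTop.eventually (h2 (J i)))
  have hJψ : StrictMono (fun i => J (ψ i)) := by
    intro i k hik
    by_contra hlt
    exact hR i k hik ((hJ (ψ k)).trans (hc.monotone (not_lt.1 hlt)))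
  -- The antichain index is shifted by one because a point lies below the chain element of its own
  -- index, whereas `F7` requires `i < j`.
  refine contains_F7 (a := fun k => a (φ (ψ (k + 1)))) (c := fun j => c (J (ψ j)))
    (fun i j hij => ?_) (hc.comp hJψ) (fun k j => ⟨fun hkj => ?_, fun hkj => ?_⟩)
    (fun i j => hca _ _)
  · have := hψ.injective (hφ.injective (ha _ _ hij))
    omega
  · by_contra hlt
    exact hR j (k + 1) (by omega) hkj
  · exact (hJ _).trans (hc.monotone (hJψ.monotone hkj))

/-- Two decreasing sequences which are termwise incomparable, with an increasing sequence on top,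
yield `F5` or `F6`. -/
theorem contains_of_two_chains {u v c : ℕ → P} (hu : StrictAnti u) (hv : StrictAnti v)
    (huv : ∀ i, ¬ u i ≤ v i) (hvu : ∀ i, ¬ v i ≤ u i) (hc : StrictMono c)
    (huc : u 0 < c 0) (hvc : v 0 < c 0) : ContainsForbidden P := by
  -- A point `u a` above no later `v n` is incomparable to the whole tail of `v`, which gives `F5`.
  have key : ∀ {u v : ℕ → P}, StrictAnti u → StrictAnti v → (∀ i, ¬ u i ≤ v i) →
      u 0 < c 0 → v 0 < c 0 → ∀ a, (∀ n, a ≤ n → ¬ v n ≤ u a) → ContainsForbidden P := by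
    intro u v hu hv huv huc hvc a h
    refine contains_F5 (p := u a) (d := fun n => v (a + n)) (fun i j hij => hv (by omega)) hc
      (fun i hi => huv a (hi.trans (hv.antitone (by omega)))) (fun i => h _ (by omega))
      ((hu.antitone (Nat.zero_le a)).trans_lt huc) ((hv.antitone (Nat.zero_le _)).trans_lt hvc)
  by_cases h1 : ∃ a, ∀ n, a ≤ n → ¬ v n ≤ u a
  · obtain ⟨a, h⟩ := h1
    exact key hu hv huv huc hvc a h
  by_cases h2 : ∃ a, ∀ n, a ≤ n → ¬ u n ≤ v a
  · obtain ⟨a, h⟩ := h2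
    exact key hv hu hvu hvc huc a h
  push Not at h1 h2
  -- Otherwise each sequence eventually drops below every term of the other, and thinning produces
  -- the levels of `F6`.
  obtain ⟨φ, hφ, hR⟩ := exists_strictMono_of_eventually
    (R := fun i k => u k < v i ∧ v k < u i) (fun i => by
      obtain ⟨n, -, hn⟩ := h1 i
      obtain ⟨m, -, hm⟩ := h2 i
      filter_upwards [eventually_gt_atTop n, eventually_gt_atTop m] with k hk hk'
      exact ⟨(hu hk').trans_le hm, (hv hk).trans_le hn⟩)
  exact contains_F6 (u := u ∘ φ) (v := v ∘ φ) (fun i => huv _) (fun i => hvu _)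
    (fun i j hij => ⟨hu (hφ hij), (hR i j hij).1⟩) (fun i j hij => ⟨(hR i j hij).2, hv (hφ hij)⟩) hc
    ((hu.antitone (Nat.zero_le _)).trans_lt huc) ((hv.antitone (Nat.zero_le _)).trans_lt hvc)

/-- Passing to later indices in both sequences preserves the relation `X m ≤ Y n`. -/
def ShiftMono (X Y : ℤ → P) : Prop :=
  ∀ m n : ℤ, X m ≤ Y n → X (m + 1) ≤ Y (n + 1)

theorem ShiftMono.add {X Y : ℤ → P} (h : ShiftMono X Y) {m n : ℤ} (hmn : X m ≤ Y n) (k : ℕ) :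
    X (m + k) ≤ Y (n + k) := by
  induction k with
  | zero => simpa using hmn
  | succ k ih => simpa [add_assoc] using h _ _ ih

theorem ShiftMono.le {X Y : ℤ → P} (h : ShiftMono X Y) {m n m' n' : ℤ} (hmn : X m ≤ Y n)
    (h1 : m ≤ m') (h2 : m' - m = n' - n) : X m' ≤ Y n' := by
  have := h.add hmn (m' - m).toNat
  rw [Int.toNat_of_nonneg (by omega)] at this
  convert this using 2 <;> omega

theorem ShiftMono.scale {X Y : ℤ → P} (h : ShiftMono X Y) {d : ℤ} (hd : 0 ≤ d) (b : ℤ) :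
    ShiftMono (fun n => X (b + d * n)) (fun n => Y (b + d * n)) := fun m n hmn =>
  h.le hmn (by linarith) (by ring)

theorem ShiftMono.dual {X Y : ℤ → P} (h : ShiftMono X Y) :
    ShiftMono (fun n => OrderDual.toDual (Y n)) (fun n => OrderDual.toDual (X n)) :=
  fun m n hmn => h n m hmn

/-- A single orbit, in the normalized form where the new relation is between neighbours. -/
theorem contains_of_orbit_neighbours {X : ℤ → P} (hX : X.Injective) (h : ShiftMono X X)
    (h0 : X 0 ≤ X 1) (h1 : ¬ X (-1) ≤ X 0) : ContainsForbidden P := by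
  have hc : StrictMono (fun n : ℕ => X n) := by
    refine strictMono_nat_of_lt_succ fun n => lt_of_le_of_ne ?_ fun he => ?_
    · exact h.le h0 (by omega) (by push_cast; ring)
    · have := hX he
      push_cast at this
      omega
  have hle : ∀ m n, X m ≤ X n → m ≤ n := by
    intro m n hmn
    by_contra hlt
    -- Pushed forward to nonnegative indices, a backward relation contradicts the increasing chain
    -- found there.
    have h2 := h.add hmn n.natAbs
    have h3 : X (n + n.natAbs) < X (m + n.natAbs) := by
      have := @hc (n + n.natAbs).toNat (m + n.natAbs).toNat (by omega)
      simpa only [Int.toNat_of_nonneg (show 0 ≤ n + n.natAbs by omega),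
        Int.toNat_of_nonneg (show 0 ≤ m + n.natAbs by omega)] using this
    exact h3.not_ge h2
  have hneg : ∀ n, n < 0 → ¬ X n ≤ X (n + 1) := fun n hn hle =>
    h1 (h.le hle (by omega) (by omega))
  -- Ramsey on the negative half: a subsequence descends, or, since relations only go forward in the
  -- index, it is an antichain.
  obtain ⟨g, hg⟩ := exists_increasing_or_nonincreasing_subseq (· > ·) (fun n : ℕ => X (-1 - n))
  rcases hg with hg | hg
  · have hg' : ∀ i j : ℕ, i < j → X (g 0 - g j) < X (g 0 - g i) := by
      intro i j hij
      have h2 : X (-1 - g j) < X (-1 - g i) := hg i j hij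
      have h3 : g i < g j := g.strictMono hij
      refine lt_of_le_of_ne (h.le h2.le (by omega) (by omega)) fun he => ?_
      have := hX he
      omega
    have hg0 : ∀ i : ℕ, 0 < i → g 0 < g i := fun i hi => g.strictMono hi
    -- The descending subsequence is shifted by `g 0 + 1` so that it starts at `X 0`; that first
    -- term is then dropped. It and its successor sequence lie under `X 1`, and they are termwise
    -- incomparable because neighbours at negative indices are unrelated.
    refine contains_of_two_chains (u := fun i => X (g 0 - g (i + 1)))
      (v := fun i => X (g 0 - g (i + 1) + 1)) (c := fun n => X (n + 1))
      (fun i j hij => hg' _ _ (by omega)) (fun i j hij => ?_) (fun i => hneg _ ?_)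
      (fun i hi => ?_) (fun i j hij => ?_) ?_ ?_
    · have h3 : g (i + 1) < g (j + 1) := g.strictMono (by omega)
      refine lt_of_le_of_ne (h _ _ (hg' (i + 1) (j + 1) (by omega)).le) fun he => ?_
      have := hX he
      omega
    · have := hg0 (i + 1) (by omega)
      omega
    · have := hle _ _ hi
      omega
    · simpa using @hc (i + 1) (j + 1) (by omega)
    · have := hg' 0 1 (by omega)
      rw [sub_self] at this
      exact this.trans_le (by simpa using h0)
    · have := hg' 0 1 (by omega)
      rw [sub_self] at this
      refine lt_of_le_of_ne (h _ _ this.le) fun he => ?_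
      have := hX he
      have := hg0 (0 + 1) (by omega)
      omega
  · refine contains_of_antichain_chain (a := fun i => X (-1 - g i)) (fun i j hij => ?_) hc
      (fun i j hij => ?_)
    · have h2 := hle _ _ hij
      rcases lt_trichotomy i j with hlt | heq | hlt
      · have := g.strictMono hlt
        omega
      · exact heq
      · have h3 := g.strictMono hlt
        refine absurd (lt_of_le_of_ne hij fun he => ?_) (hg j i hlt)
        have := hX he
        omega
    · have := hle _ _ hij
      omega

theorem contains_of_orbit {X : ℤ → P} (hX : X.Injective) (h : ShiftMono X X) {m n : ℤ}
    (h0 : X (m + 1) ≤ X (n + 1)) (h1 : ¬ X m ≤ X n) : ContainsForbidden P := by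
  rcases lt_trichotomy m n with hlt | heq | hlt
  · refine contains_of_orbit_neighbours (X := fun k => X (m + 1 + (n - m) * k)) ?_
      (h.scale (by omega) _) ?_ ?_
    · intro i j hij
      have := hX hij
      exact mul_left_cancel₀ (show n - m ≠ 0 by omega) (by linarith)
    · convert h0 using 2 <;> ring
    · intro h2
      exact h1 (h.le h2 (by omega) (by ring))
  · exact absurd (heq ▸ le_rfl) h1
  · refine ContainsForbidden.of_dual (contains_of_orbit_neighbours
      (X := fun k => OrderDual.toDual (X (n + 1 + (m - n) * k))) ?_
      (h.scale (by omega) _).dual ?_ ?_)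
    · intro i j hij
      have := hX hij
      exact mul_left_cancel₀ (show m - n ≠ 0 by omega) (by linarith)
    · rw [OrderDual.toDual_le_toDual]
      convert h0 using 2 <;> ring
    · rw [OrderDual.toDual_le_toDual]
      intro h2
      exact h1 (h.le h2 (by omega) (by ring))

/-- A sequence on which the shift is an automorphism is, after passing to multiples, an antichain
or a chain. -/
theorem antichain_or_chain {X : ℤ → P} (hX : X.Injective)
    (h : ∀ m n : ℤ, X m ≤ X n ↔ X (m + 1) ≤ X (n + 1)) :
    (∀ m n, X m ≤ X n → m = n) ∨ (∃ d : ℤ, 0 < d ∧ StrictMono fun n => X (d * n)) ∨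
      ∃ d : ℤ, 0 < d ∧ StrictAnti fun n => X (d * n) := by
  by_cases hanti : ∀ m n, X m ≤ X n → m = n
  · exact .inl hanti
  right
  push Not at hanti
  obtain ⟨m, n, hmn, hne⟩ := hanti
  have hk : ∀ k : ℕ, ∀ m n : ℤ, X m ≤ X n ↔ X (m + k) ≤ X (n + k) := by
    intro k
    induction k with
    | zero => simp
    | succ k ih =>
      intro m n
      rw [ih, h]
      push_cast
      simp only [add_assoc]
  have hall : ∀ k : ℤ, X (m + k) ≤ X (n + k) := by
    intro k
    rcases le_total 0 k with hk0 | hk0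
    · have := (hk k.toNat m n).1 hmn
      rwa [Int.toNat_of_nonneg hk0] at this
    · refine (hk (-k).toNat _ _).2 ?_
      rw [Int.toNat_of_nonneg (by omega)]
      simpa using hmn
  rcases lt_or_gt_of_ne hne with hlt | hlt
  · refine .inl ⟨n - m, by omega, strictMono_int_of_lt_succ fun k => lt_of_le_of_ne ?_ fun he => ?_⟩
    · convert hall ((n - m) * k - m) using 2 <;> ring
    · have := hX he
      rw [mul_add] at this
      omega
  · refine .inr ⟨m - n, by omega, strictAnti_int_of_succ_lt fun k => lt_of_le_of_ne ?_ fun he => ?_⟩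
    · convert hall ((m - n) * k - n) using 2 <;> ring
    · have := hX he
      rw [mul_add] at this
      omega

/-- A fixed point together with an infinite orbit. -/
theorem contains_of_fixed_orbit {p : P} {X : ℤ → P} (hX : X.Injective)
    (h : ∀ m n : ℤ, X m ≤ X n ↔ X (m + 1) ≤ X (n + 1)) (hpX : ∀ n, p ≤ X n → p ≤ X (n + 1))
    (hXp : ∀ n, X n ≤ p → X (n + 1) ≤ p) (h0 : p ≤ X 0) (h1 : ¬ p ≤ X (-1)) :
    ContainsForbidden P := by
  have up : ∀ m n, m ≤ n → p ≤ X m → p ≤ X n := fun m n hmn hm =>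
    Int.leInduction hm (fun n _ ih => hpX n ih) n hmn
  have up' : ∀ m n, m ≤ n → X m ≤ p → X n ≤ p := fun m n hmn hm =>
    Int.leInduction hm (fun n _ ih => hXp n ih) n hmn
  have hneg : ∀ n, n < 0 → ¬ p ≤ X n := fun n hn hle => h1 (up _ _ (by omega) hle)
  -- Such a relation persists forward alongside `p ≤ X k`, making the orbit eventually constant.
  have hnot : ∀ n, ¬ X n ≤ p := by
    intro n hn
    have key : ∀ k, max n 0 ≤ k → X k = p := fun k hk =>
      le_antisymm (up' n k (by omega) hn) (up 0 k (by omega) h0)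
    have := hX ((key (max n 0) le_rfl).trans (key (max n 0 + 1) (by omega)).symm)
    omega
  rcases antichain_or_chain hX h with ha | ⟨d, hd, hm⟩ | ⟨d, hd, hm⟩
  · refine contains_F2 (p := p) (a := fun n => X n) (b := fun n => X (-1 - n))
      (fun i j hij => ?_) (fun i j hij => ?_) (fun i => ?_) (fun i => hneg _ (by omega))
      (fun i => hnot _) (fun i j hij => ?_) (fun i j hij => ?_)
    · exact_mod_cast ha _ _ hij
    · have := ha _ _ hij
      omega
    · exact (up 0 i (by omega) h0).lt_of_not_ge (hnot _)
    · have := ha _ _ hij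
      omega
    · have := ha _ _ hij
      omega
  · refine contains_F5 (p := p) (d := fun n => X (d * (-1 - n))) (c := fun n => X (d * n))
      (fun i j hij => hm (by omega)) (fun i j hij => hm (by omega)) (fun i => hneg _ ?_)
      (fun i => hnot _) ?_ (hm (by omega))
    · exact mul_neg_of_pos_of_neg hd (by omega)
    · simpa using h0.lt_of_not_ge (hnot _)
  -- A decreasing orbit is impossible: `p ≤ X 0 ≤ X (-d)` would persist forward to index -1.
  · refine absurd (up (d * (-1)) (-1) (by omega) (h0.trans ?_)) h1
    simpa using (hm (show (-1 : ℤ) < 0 by omega)).le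

end Orbits

/-! ### Two infinite orbits -/

section TwoOrbits

variable {P : Type*} [PartialOrder P]

/-- An element below infinitely many and not below infinitely many elements of an antichain. -/
theorem contains_of_infinite_infinite {p : P} {Y : ℤ → P}
    (hY : ∀ m n, Y m ≤ Y n → m = n) (hYp : ∀ n, ¬ Y n ≤ p)
    (h1 : {n | p ≤ Y n}.Infinite) (h2 : {n | p ≤ Y n}ᶜ.Infinite) : ContainsForbidden P := by
  let a := h1.natEmbedding
  let b := h2.natEmbedding
  refine contains_F2 (p := p) (a := fun n => Y (a n)) (b := fun n => Y (b n))
    (fun i j hij => a.injective (Subtype.ext (hY _ _ hij)))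
    (fun i j hij => b.injective (Subtype.ext (hY _ _ hij)))
    (fun i => lt_of_le_not_ge (a i).2 (hYp _)) (fun i => (b i).2) (fun i => hYp _)
    (fun i j hij => ?_) (fun i j hij => ?_)
  · exact (b j).2 (hY _ _ hij ▸ (a i).2)
  · exact (b i).2 ((hY _ _ hij).symm ▸ (a j).2)

/-- Two infinite orbits, on each of which the shift is an automorphism, such that the shift adds
a relation between equally indexed elements. -/
structure OrbitPair (X Y : ℤ → P) : Prop where
  injX : X.Injective
  injY : Y.Injective
  xy : ShiftMono X Y
  yx : ShiftMono Y X
  ne : ∀ m n, X m ≠ Y n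
  le_zero : X 0 ≤ Y 0
  not_le : ¬ X (-1) ≤ Y (-1)

namespace OrbitPair

variable {X Y : ℤ → P}

theorem scale (h : OrbitPair X Y) {d : ℤ} (hd : 0 < d) :
    OrbitPair (fun n => X (d * n)) (fun n => Y (d * n)) where
  injX _ _ hij := mul_left_cancel₀ hd.ne' (h.injX hij)
  injY _ _ hij := mul_left_cancel₀ hd.ne' (h.injY hij)
  xy := by simpa using h.xy.scale hd.le 0
  yx := by simpa using h.yx.scale hd.le 0
  ne _ _ := h.ne _ _
  le_zero := by simpa using h.le_zero
  not_le hle := h.not_le (h.xy.le hle (by omega) (by ring))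

theorem dual (h : OrbitPair X Y) :
    OrbitPair (fun n => OrderDual.toDual (Y n)) (fun n => OrderDual.toDual (X n)) where
  injX := h.injY
  injY := h.injX
  xy := h.xy.dual
  yx := h.yx.dual
  ne m n := (h.ne n m).symm
  le_zero := h.le_zero
  not_le := h.not_le

theorem lt_of_nonneg (h : OrbitPair X Y) {n : ℤ} (hn : 0 ≤ n) : X n < Y n :=
  (h.xy.le h.le_zero hn (by ring)).lt_of_ne (h.ne _ _)

theorem not_le_of_neg (h : OrbitPair X Y) {n : ℤ} (hn : n < 0) : ¬ X n ≤ Y n := fun hle =>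
  h.not_le (h.xy.le hle (by omega) (by omega))

/-- A relation `Y m ≤ X n` persists at arbitrarily large indices. -/
theorem exists_of_ge (h : OrbitPair X Y) {m n : ℤ} (hmn : Y m ≤ X n) :
    ∃ k : ℤ, 0 ≤ m + k ∧ 0 ≤ n + k ∧ Y (m + k) ≤ X (n + k) :=
  ⟨m.natAbs + n.natAbs, by omega, by omega, h.yx.le hmn (by omega) (by omega)⟩

theorem not_ge (h : OrbitPair X Y) (n : ℤ) : ¬ Y n ≤ X n := fun hle => by
  obtain ⟨k, hk, -, hle⟩ := h.exists_of_ge hle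
  exact (h.lt_of_nonneg hk).not_ge hle

/-- The chain `X 0 > X (-1) > ⋯` lies below every `Y i` with `i ≥ 0`, because `X 0 ≤ X i < Y i`;
this is the dual of `F4`. -/
theorem contains_of_mono_antichain (h : OrbitPair X Y) (hX : StrictMono X)
    (hY : ∀ m n, Y m ≤ Y n → m = n) : ContainsForbidden P := by
  refine ContainsForbidden.of_dual (contains_F4 (a := fun n : ℕ => OrderDual.toDual (Y n))
    (c := fun n : ℕ => OrderDual.toDual (X (-n))) (fun i j hij => ?_) (fun i j hij => ?_)
    (fun i j => ?_))
  · exact_mod_cast (hY _ _ hij).symm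
  · exact hX (by omega)
  · exact (hX.monotone (by omega)).trans_lt (h.lt_of_nonneg (n := i) (by omega))

theorem contains_of_antichain_mono (h : OrbitPair X Y) (hX : ∀ m n, X m ≤ X n → m = n)
    (hY : StrictMono Y) : ContainsForbidden P := by
  refine contains_of_antichain_chain (a := fun n : ℕ => X n) (c := fun n : ℕ => Y n)
    (fun i j hij => by exact_mod_cast hX _ _ hij) (fun i j hij => hY (by omega))
    (fun i j hij => ?_)
  have h1 := hX _ _ ((h.lt_of_nonneg (n := j) (by omega)).le.trans hij)
  rw [h1] at hij
  exact h.not_ge _ hij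

/-- The negative halves are descending and termwise incomparable, and the nonnegative half of `Y`
lies on top of both. -/
theorem contains_of_mono_mono (h : OrbitPair X Y) (hX : StrictMono X) (hY : StrictMono Y) :
    ContainsForbidden P := by
  refine contains_of_two_chains (u := fun n : ℕ => X (-1 - n)) (v := fun n : ℕ => Y (-1 - n))
    (c := fun n : ℕ => Y n) (fun i j hij => hX (by omega)) (fun i j hij => hY (by omega))
    (fun i => h.not_le_of_neg (by omega)) (fun i => h.not_ge _) (fun i j hij => hY (by omega))
    ?_ (hY (by omega))
  exact (hX (by omega)).trans (h.lt_of_nonneg (n := 0) le_rfl)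

theorem not_mono_anti (h : OrbitPair X Y) (hX : StrictMono X) (hY : StrictAnti Y) : False :=
  h.not_le ((hX.monotone (by omega)).trans (h.le_zero.trans (hY.antitone (by omega))))

/-- Either `Y (-1)` lies over the descending half of `X` but not over its ascending half, giving the
dual of `F5`, or `X 0` lies under the ascending half of `Y` but not under a tail of its descending
half, giving `F5`. -/
theorem contains_of_anti_mono (h : OrbitPair X Y) (hX : StrictAnti X) (hY : StrictMono Y) :
    ContainsForbidden P := by
  have hge : ∀ m n, ¬ Y m ≤ X n := by
    intro m n hmn
    obtain ⟨k, hm, hn, hle⟩ := h.exists_of_ge hmn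
    rcases le_total m n with hle' | hle'
    · exact h.not_ge _ (hle.trans (hX.antitone (add_le_add_left hle' k)))
    · exact h.not_ge _ ((hY.monotone (add_le_add_left hle' k)).trans hle)
  by_cases h1 : ∀ n : ℕ, X 0 ≤ Y (-1 - n)
  · refine ContainsForbidden.of_dual (contains_F5 (p := OrderDual.toDual (Y (-1)))
      (d := fun n : ℕ => OrderDual.toDual (X (-1 - n)))
      (c := fun n : ℕ => OrderDual.toDual (X n)) (fun i j hij => hX (by omega))
      (fun i j hij => hX (by omega)) (fun i hi => ?_) (fun i => hge _ _) ?_ (hX (by omega)))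
    · exact h.not_le ((hX.antitone (by omega)).trans hi)
    · exact lt_of_le_of_ne (h1 0) (h.ne _ _).symm
  · push Not at h1
    obtain ⟨k, hk⟩ := h1
    refine contains_F5 (p := X 0) (d := fun n : ℕ => Y (-1 - k - n)) (c := fun n : ℕ => Y n)
      (fun i j hij => hY (by omega)) (fun i j hij => hY (by omega)) (fun i hi => ?_)
      (fun i => hge _ _) (h.lt_of_nonneg (n := 0) le_rfl) (hY (by omega))
    exact hk (hi.trans (hY.monotone (by omega)))

/-- Only relations `X n ≤ Y m` occur, so this is a bipartite graph. A neighbourhood that is neither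
finite nor cofinite gives `F2` or its dual. Otherwise shifting makes all neighbourhoods finite,
leaving an induced matching on nonnegative indices (`F3`), or all cofinite, leaving the complement
of a matching on negative ones (`F8`). -/
theorem contains_of_antichain_antichain (h : OrbitPair X Y) (hX : ∀ m n, X m ≤ X n → m = n)
    (hY : ∀ m n, Y m ≤ Y n → m = n) : ContainsForbidden P := by
  have hge : ∀ m n, ¬ Y m ≤ X n := by
    intro m n hmn
    obtain ⟨k, hm, hn, hle⟩ := h.exists_of_ge hmn
    have := hY _ _ (hle.trans (h.lt_of_nonneg hn).le)
    obtain rfl : m = n := by omega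
    exact h.not_ge _ hmn
  by_cases hN : ∃ n, {m | X n ≤ Y m}.Infinite ∧ {m | X n ≤ Y m}ᶜ.Infinite
  · obtain ⟨n, h1, h2⟩ := hN
    exact contains_of_infinite_infinite hY (fun m => hge m n) h1 h2
  by_cases hM : ∃ m, {n | X n ≤ Y m}.Infinite ∧ {n | X n ≤ Y m}ᶜ.Infinite
  · obtain ⟨m, h1, h2⟩ := hM
    exact ContainsForbidden.of_dual (contains_of_infinite_infinite (p := OrderDual.toDual (Y m))
      (Y := fun n => OrderDual.toDual (X n)) (fun i j hij => (hX _ _ hij).symm)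
      (fun n => hge m n) h1 h2)
  have cofinal : ∀ {s : Set ℤ} (K : ℤ), (∀ m, K ≤ m → m ∈ s) → s.Infinite := fun K hK =>
    (Set.Ici_infinite K).mono fun m hm => hK m hm
  have coinitial : ∀ {s : Set ℤ} (K : ℤ), (∀ m, m ≤ K → m ∈ s) → s.Infinite := fun K hK =>
    (Set.Iic_infinite K).mono fun m hm => hK m hm
  -- A relation from `X n` to a `Y k` with `k` very negative would shift to `X n' ≤ Y m` with `n'`
  -- beyond the bound.
  have finM : ∀ m, {n | X n ≤ Y m}.Finite → ∀ n, {m | X n ≤ Y m}ᶜ.Infinite := by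
    intro m hm n
    obtain ⟨B, hB⟩ := hm.bddAbove
    refine coinitial (m - (B.natAbs + 1 + n.natAbs)) fun k hk hle => ?_
    have := hB (h.xy.le hle (m' := n + (m - k)) (n' := m) (by omega) (by ring))
    omega
  -- Points of `X` far enough back are below `Y m`; shifting such a relation forward to `X n`
  -- reaches every sufficiently late `Y k`.
  have cofinM : ∀ m, {n | X n ≤ Y m}ᶜ.Finite → ∀ n, {m | X n ≤ Y m}.Infinite := by
    intro m hm n
    obtain ⟨B, hB⟩ := hm.bddBelow
    refine cofinal (m + (B.natAbs + 1 + n.natAbs)) fun k hk => ?_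
    have : X (n + (m - k)) ≤ Y m := by
      by_contra hle
      have := hB hle
      omega
    exact h.xy.le this (by omega) (by ring)
  push Not at hN hM
  have evN : ∀ {s : Set ℤ} {g : ℕ → ℤ}, g.Injective → s.Finite → ∀ᶠ k in atTop, g k ∉ s := by
    intro s g hg hs
    rw [← Nat.cofinite_eq_atTop]
    exact hg.tendsto_cofinite.eventually hs.compl_mem_cofinite
  by_cases h0 : {n | X n ≤ Y 0}.Infinite
  · have infN := cofinM 0 (hM 0 h0)
    have finNc : ∀ n, {m | X n ≤ Y m}ᶜ.Finite := fun n => hN n (infN n)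
    have finMc : ∀ m, {n | X n ≤ Y m}ᶜ.Finite := fun m => by
      by_contra hfin
      have : {n | X n ≤ Y m}.Finite := by
        by_contra hinf
        exact hfin (hM m hinf)
      exact finM m this 0 (finNc 0)
    have hg : Function.Injective (fun k : ℕ => (-1 - k : ℤ)) := fun i j hij => by
      simpa using hij
    obtain ⟨φ, hφ, hR⟩ := exists_strictMono_of_eventually
      (R := fun i k => X (-1 - i) ≤ Y (-1 - k) ∧ X (-1 - k) ≤ Y (-1 - i)) (fun i => by
        filter_upwards [evN hg (finNc (-1 - i)), evN hg (finMc (-1 - i))] with k h1 h2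
        exact ⟨not_not.1 h1, not_not.1 h2⟩)
    refine contains_F8 (x := fun i => X (-1 - φ i)) (y := fun i => Y (-1 - φ i))
      (fun i j hij => ?_) (fun i j hij => ?_) (fun i j => ⟨?_, fun hij => ?_⟩) (fun i j => hge _ _)
    · exact hφ.injective (hg (hX _ _ hij))
    · exact hφ.injective (hg (hY _ _ hij))
    · rintro hle rfl
      exact h.not_le_of_neg (by omega) hle
    · rcases lt_or_gt_of_ne hij with hlt | hlt
      · exact (hR _ _ hlt).1
      · exact (hR _ _ hlt).2
  · rw [Set.not_infinite] at h0
    have finN : ∀ n, {m | X n ≤ Y m}.Finite := fun n => by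
      by_contra hinf
      exact finM 0 h0 n (hN n hinf)
    have finM' : ∀ m, {n | X n ≤ Y m}.Finite := fun m => by
      by_contra hinf
      exact cofinM m (hM m hinf) 0 (finN 0)
    have hg : Function.Injective (fun k : ℕ => (k : ℤ)) := Nat.cast_injective
    obtain ⟨φ, hφ, hR⟩ := exists_strictMono_of_eventually
      (R := fun i k => ¬ X i ≤ Y k ∧ ¬ X k ≤ Y i) (fun i => by
        filter_upwards [evN hg (finN i), evN hg (finM' i)] with k h1 h2
        exact ⟨h1, h2⟩)
    refine contains_F3 (x := fun i => X (φ i)) (y := fun i => Y (φ i))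
      (fun i j hij => ?_) (fun i j hij => ?_) (fun i j => ⟨fun hle => ?_, ?_⟩) (fun i j => hge _ _)
    · exact hφ.injective (hg (hX _ _ hij))
    · exact hφ.injective (hg (hY _ _ hij))
    · by_contra hij
      rcases lt_or_gt_of_ne hij with hlt | hlt
      · exact (hR _ _ hlt).1 hle
      · exact (hR _ _ hlt).2 hle
    · rintro rfl
      exact (h.lt_of_nonneg (by omega)).le

theorem contains (h : OrbitPair X Y) (hX : ∀ m n : ℤ, X m ≤ X n ↔ X (m + 1) ≤ X (n + 1))
    (hY : ∀ m n : ℤ, Y m ≤ Y n ↔ Y (m + 1) ≤ Y (n + 1)) : ContainsForbidden P := by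
  have scaleMono : ∀ {Z : ℤ → P} {d e : ℤ}, StrictMono (fun n => Z (d * n)) → 0 < e →
      StrictMono fun n => Z (d * e * n) := fun {Z d e} hZ he m n hmn => by
    simpa only [mul_assoc] using hZ (mul_lt_mul_of_pos_left hmn he)
  have scaleAnti : ∀ {Z : ℤ → P} {d e : ℤ}, StrictAnti (fun n => Z (d * n)) → 0 < e →
      StrictAnti fun n => Z (d * e * n) := fun {Z d e} hZ he m n hmn => by
    simpa only [mul_assoc] using hZ (mul_lt_mul_of_pos_left hmn he)
  have scaleAntichain : ∀ {Z : ℤ → P} {d : ℤ}, (∀ m n, Z m ≤ Z n → m = n) → 0 < d →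
      ∀ m n, Z (d * m) ≤ Z (d * n) → m = n := fun hZ hd m n hmn =>
    mul_left_cancel₀ hd.ne' (hZ _ _ hmn)
  rcases antichain_or_chain h.injX hX with hX | ⟨d, hd, hX⟩ | ⟨d, hd, hX⟩ <;>
    rcases antichain_or_chain h.injY hY with hY | ⟨e, he, hY⟩ | ⟨e, he, hY⟩
  · exact h.contains_of_antichain_antichain hX hY
  · exact (h.scale he).contains_of_antichain_mono (scaleAntichain hX he) hY
  · exact ContainsForbidden.of_dual ((h.scale he).dual.contains_of_mono_antichain hY.dual_right
      fun m n hmn => (scaleAntichain hX he _ _ hmn).symm)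
  · exact (h.scale hd).contains_of_mono_antichain hX (scaleAntichain hY hd)
  · exact (h.scale (mul_pos hd he)).contains_of_mono_mono (scaleMono hX he)
      (mul_comm d e ▸ scaleMono hY hd)
  · exact ((h.scale (mul_pos hd he)).not_mono_anti (scaleMono hX he)
      (mul_comm d e ▸ scaleAnti hY hd)).elim
  · exact ContainsForbidden.of_dual ((h.scale hd).dual.contains_of_antichain_mono
      (fun m n hmn => (scaleAntichain hY hd _ _ hmn).symm) hX.dual_right)
  · exact (h.scale (mul_pos hd he)).contains_of_anti_mono (scaleAnti hX he)
      (mul_comm d e ▸ scaleMono hY hd)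
  · exact ContainsForbidden.of_dual ((h.scale (mul_pos hd he)).dual.contains_of_mono_mono
      (mul_comm d e ▸ scaleAnti hY hd).dual_right (scaleAnti hX he).dual_right)

end OrbitPair

/-! ### From a monotone permutation to orbits -/

theorem zpow_apply_injective {α : Type*} (e : Equiv.Perm α) {x : α}
    (hx : ∀ k : ℕ, 0 < k → (e ^ k) x ≠ x) : Function.Injective fun n : ℤ => (e ^ n) x := by
  have key : ∀ m n : ℤ, m < n → (e ^ m) x ≠ (e ^ n) x := by
    intro m n hmn he
    refine hx (n - m).toNat (by omega) ?_
    rw [← zpow_natCast, Int.toNat_of_nonneg (by omega), sub_eq_neg_add, zpow_add,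
      Equiv.Perm.mul_apply, ← he, ← Equiv.Perm.mul_apply, ← zpow_add, neg_add_cancel, zpow_zero,
      Equiv.Perm.one_apply]
  intro m n he
  by_contra hne
  rcases lt_or_gt_of_ne hne with h | h
  · exact key m n h he
  · exact key n m h he.symm

theorem monotone_perm_pow {e : Equiv.Perm P} (he : Monotone e) (k : ℕ) :
    Monotone (e ^ k : Equiv.Perm P) := by
  rw [Equiv.Perm.coe_pow]
  exact he.iterate k

theorem shiftMono_zpow {e : Equiv.Perm P} (he : Monotone e) (x y : P) :
    ShiftMono (fun n => (e ^ n) x) (fun n => (e ^ n) y) := by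
  intro m n hmn
  simp only [add_comm _ (1 : ℤ), zpow_add, zpow_one, Equiv.Perm.mul_apply]
  exact he hmn

theorem contains_or_zpow_iff {e : Equiv.Perm P} (he : Monotone e) {x : P}
    (hx : ∀ k : ℕ, 0 < k → (e ^ k) x ≠ x) :
    ContainsForbidden P ∨
      ∀ m n : ℤ, (e ^ m) x ≤ (e ^ n) x ↔ (e ^ (m + 1)) x ≤ (e ^ (n + 1)) x := by
  refine or_iff_not_imp_left.2 fun h m n => ⟨shiftMono_zpow he x x m n, fun hle => ?_⟩
  by_contra hnot
  exact h (contains_of_orbit (zpow_apply_injective e hx) (shiftMono_zpow he x x) hle hnot)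

/-- A periodic point and a point with an infinite orbit. -/
theorem contains_of_periodic {e : Equiv.Perm P} (he : Monotone e) {x y : P} {k : ℕ} (hk : 0 < k)
    (hx : (e ^ k) x = x) (hy : ∀ k : ℕ, 0 < k → (e ^ k) y ≠ y) (hxy : ¬ x ≤ y)
    (hexy : e x ≤ e y) : ContainsForbidden P := by
  -- `f` fixes `x` and still gains the relation to `y`. The orbit is based at `f y`, so that index 0
  -- has the relation and index -1, which is `y`, lacks it.
  set f := e ^ k with hf
  have hfm : Monotone f := monotone_perm_pow he k
  have hle : x ≤ f y := by
    obtain ⟨l, rfl⟩ : ∃ l, k = l + 1 := ⟨k - 1, by omega⟩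
    have := monotone_perm_pow he l hexy
    rw [← Equiv.Perm.mul_apply, ← Equiv.Perm.mul_apply, ← pow_succ, ← hf, hx] at this
    exact this
  have hfy : ∀ j : ℕ, 0 < j → (f ^ j) (f y) ≠ f y := by
    intro j hj h
    rw [← Equiv.Perm.mul_apply, ← pow_succ, pow_succ', Equiv.Perm.mul_apply, f.injective.eq_iff,
      hf, ← pow_mul] at h
    exact hy _ (mul_pos hk hj) h
  rcases contains_or_zpow_iff hfm hfy with h | h
  · exact h
  have succ_apply : ∀ n : ℤ, (f ^ (n + 1)) (f y) = f ((f ^ n) (f y)) := fun n => by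
    rw [add_comm, zpow_add, zpow_one, Equiv.Perm.mul_apply]
  refine contains_of_fixed_orbit (p := x) (zpow_apply_injective f hfy) h (fun n hn => ?_)
    (fun n hn => ?_) (by simpa using hle) (by simpa using hxy)
  · rw [succ_apply]
    exact hx.symm.trans_le (hfm hn)
  · rw [succ_apply]
    exact (hfm hn).trans_eq hx

/-- A monotone permutation whose inverse is not monotone forces a forbidden poset. -/
theorem contains_of_monotone_perm {e : Equiv.Perm P} (he : Monotone e) {x y : P} (hxy : ¬ x ≤ y)
    (hexy : e x ≤ e y) : ContainsForbidden P := by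
  by_cases hx : ∀ k : ℕ, 0 < k → (e ^ k) x ≠ x
  swap
  · push Not at hx
    obtain ⟨k, hk, hx⟩ := hx
    by_cases hy : ∀ k : ℕ, 0 < k → (e ^ k) y ≠ y
    · exact contains_of_periodic he hk hx hy hxy hexy
    push Not at hy
    obtain ⟨l, hl, hy⟩ := hy
    exfalso
    have hkl : 0 < k * l := mul_pos hk hl
    -- One power of `e` is already spent in `hexy`; the remaining ones bring both periodic points
    -- home and give `x ≤ y`.
    have h1 := monotone_perm_pow he (k * l - 1) hexy
    rw [← Equiv.Perm.mul_apply, ← Equiv.Perm.mul_apply, ← pow_succ, Nat.sub_add_cancel hkl] at h1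
    have hx' : (e ^ (k * l)) x = x := by
      rw [pow_mul, Equiv.Perm.coe_pow]
      exact Function.iterate_fixed hx l
    have hy' : (e ^ (k * l)) y = y := by
      rw [mul_comm, pow_mul, Equiv.Perm.coe_pow]
      exact Function.iterate_fixed hy k
    rw [hx', hy'] at h1
    exact hxy h1
  by_cases hy : ∀ k : ℕ, 0 < k → (e ^ k) y ≠ y
  swap
  · push Not at hy
    obtain ⟨k, hk, hy⟩ := hy
    exact ContainsForbidden.of_dual (contains_of_periodic (P := Pᵒᵈ) (e := e) (x := y) (y := x)
      (fun a b hab => he hab) hk hy hx hxy hexy)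
  by_cases hsame : ∃ d : ℤ, y = (e ^ d) x
  · obtain ⟨d, rfl⟩ := hsame
    refine contains_of_orbit (m := 0) (n := d) (zpow_apply_injective e hx) (shiftMono_zpow he x x)
      ?_ (by simpa using hxy)
    simpa [add_comm d, zpow_add] using hexy
  push Not at hsame
  have conj : ∀ {z : P}, (∀ k : ℕ, 0 < k → (e ^ k) z ≠ z) →
      ∀ k : ℕ, 0 < k → (e ^ k) (e z) ≠ e z := by
    intro z hz k hk h
    rw [← Equiv.Perm.mul_apply, ← pow_succ, pow_succ', Equiv.Perm.mul_apply,
      e.injective.eq_iff] at h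
    exact hz k hk h
  rcases contains_or_zpow_iff he (conj hx) with h | hX
  · exact h
  rcases contains_or_zpow_iff he (conj hy) with h | hY
  · exact h
  -- Basing the orbits at `e x` and `e y` puts the gained relation at index 0 and the missing one at
  -- index -1.
  refine OrbitPair.contains (X := fun n => (e ^ n) (e x)) (Y := fun n => (e ^ n) (e y)) ?_ hX hY
  refine ⟨zpow_apply_injective e (conj hx), zpow_apply_injective e (conj hy),
    shiftMono_zpow he _ _, shiftMono_zpow he _ _, fun m n hmn => hsame (m - n) ?_,
    by simpa using hexy, by simpa using hxy⟩
  have h1 : (e ^ (m + 1)) x = (e ^ (n + 1)) y := by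
    simpa only [zpow_add, zpow_one, Equiv.Perm.mul_apply] using hmn
  rw [show m - n = -(n + 1) + (m + 1) by ring, zpow_add, Equiv.Perm.mul_apply, h1,
    ← Equiv.Perm.mul_apply, ← zpow_add, neg_add_cancel, zpow_zero, Equiv.Perm.one_apply]

theorem contains_of_not_reversible (h : ¬ Reversible P) : ContainsForbidden P := by
  unfold Reversible at h
  push Not at h
  obtain ⟨f, hf, hbij, hne⟩ := h
  by_contra hcon
  refine hne ⟨Equiv.ofBijective f hbij, fun {x y} => ⟨fun hle => ?_, fun hle => hf hle⟩⟩ rfl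
  by_contra hxy
  exact hcon (contains_of_monotone_perm (e := Equiv.ofBijective f hbij) hf hxy hle)

end TwoOrbits

/-! ### The forbidden posets are not reversible -/

theorem Reversible.le_of_le {Q : Type*} [PartialOrder Q] (h : Reversible Q) {e : Equiv.Perm Q}
    (he : Monotone e) {x y : Q} (hxy : e x ≤ e y) : x ≤ y := by
  obtain ⟨g, hg⟩ := h e he e.bijective
  rw [← hg] at hxy
  exact g.le_iff_le.1 hxy

theorem Reversible.of_dual {Q : Type*} [PartialOrder Q] (h : Reversible Qᵒᵈ) : Reversible Q := by
  intro f hf hb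
  have he : Monotone (α := Qᵒᵈ) (β := Qᵒᵈ) (Equiv.ofBijective f hb) := fun x y hxy => hf hxy
  exact ⟨⟨Equiv.ofBijective f hb, fun {x y} => ⟨fun hxy => h.le_of_le he hxy, fun hxy => hf hxy⟩⟩,
    rfl⟩

theorem Reversible.of_orderIso {Q R : Type*} [PartialOrder Q] [PartialOrder R] (g : Q ≃o R)
    (h : Reversible Q) : Reversible R := by
  intro f hf hb
  let e := (g.toEquiv.trans (Equiv.ofBijective f hb)).trans g.symm.toEquiv
  have he : Monotone e := fun x y hxy => g.symm.monotone (hf (g.monotone hxy))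
  refine ⟨⟨Equiv.ofBijective f hb, fun {x y} => ⟨fun hxy => ?_, fun hxy => hf hxy⟩⟩, rfl⟩
  have := h.le_of_le he (x := g.symm x) (y := g.symm y) (by simpa [e] using hxy)
  simpa using this

/-- To refute reversibility of `Q`, give a permutation of a parametrizing type. -/
theorem not_reversible_of_param {Q R : Type*} [PartialOrder Q] (r : R ≃ Q) (s : R ≃ R)
    (hs : ∀ x y, r x ≤ r y → r (s x) ≤ r (s y)) (x y : R) (hxy : ¬ r x ≤ r y)
    (hsxy : r (s x) ≤ r (s y)) : ¬ Reversible Q := fun h => by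
  have he : Monotone ((r.symm.trans s).trans r) := fun x y hxy => by
    simpa using hs (r.symm x) (r.symm y) (by simpa using hxy)
  exact hxy (h.le_of_le he (by simpa using hsxy))

/-- The points of an antichain. -/
def Antichain.equiv (α : Type) : α ≃ Antichain α where
  toFun := Antichain.mk
  invFun := Antichain.val
  left_inv _ := rfl
  right_inv _ := rfl

@[simp] theorem Antichain.equiv_apply {α : Type} (x : α) : Antichain.equiv α x = ⟨x⟩ := rfl

@[simp] theorem F7.c_le_c {i j : ℕ} : F7.c i ≤ F7.c j ↔ i ≤ j := Iff.rfl
@[simp] theorem F7.d_le_d {i j : ℕ} : F7.d i ≤ F7.d j ↔ i = j := Iff.rfl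
@[simp] theorem F7.d_le_c {i j : ℕ} : F7.d i ≤ F7.c j ↔ i < j := Iff.rfl
@[simp] theorem F7.not_c_le_d {i j : ℕ} : ¬ F7.c i ≤ F7.d j := id
@[simp] theorem F8.a_le_a {i j : ℤ} : F8.a i ≤ F8.a j ↔ i = j := Iff.rfl
@[simp] theorem F8.b_le_b {i j : ℤ} : F8.b i ≤ F8.b j ↔ i = j := Iff.rfl
@[simp] theorem F8.a_le_b {i j : ℤ} : F8.a i ≤ F8.b j ↔ 0 < i ∨ j ≠ i := Iff.rfl
@[simp] theorem F8.not_b_le_a {i j : ℤ} : ¬ F8.b i ≤ F8.a j := id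

/-- Move every element of the first copy one place down and its least element to the second. -/
def transfer : ℕ ⊕ ℕ ≃ ℕ ⊕ ℕ where
  toFun
    | .inl 0 => .inr 0
    | .inl (n + 1) => .inl n
    | .inr n => .inr (n + 1)
  invFun
    | .inl n => .inl (n + 1)
    | .inr 0 => .inl 0
    | .inr (n + 1) => .inr n
  left_inv := by rintro ((_ | n) | n) <;> rfl
  right_inv := by rintro (n | (_ | n)) <;> rfl

@[simp] theorem transfer_inl_zero : transfer (.inl 0) = .inr 0 := rfl
@[simp] theorem transfer_inl_succ (n : ℕ) : transfer (.inl (n + 1)) = .inl n := rfl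
@[simp] theorem transfer_inr (n : ℕ) : transfer (.inr n) = .inr (n + 1) := rfl

/-- Move two elements of the second summand to the first. -/
def transferPair : (ℕ × Bool) ⊕ ℕ ≃ (ℕ × Bool) ⊕ ℕ where
  toFun
    | .inl (n, b) => .inl (n + 1, b)
    | .inr 0 => .inl (0, false)
    | .inr 1 => .inl (0, true)
    | .inr (n + 2) => .inr n
  invFun
    | .inl (0, false) => .inr 0
    | .inl (0, true) => .inr 1
    | .inl (n + 1, b) => .inl (n, b)
    | .inr n => .inr (n + 2)
  left_inv := by rintro (⟨n, b⟩ | (_ | _ | n)) <;> rfl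
  right_inv := by rintro (⟨_ | n, (_ | _)⟩ | n) <;> rfl

theorem not_reversible_F1 : ¬ Reversible F1 := by
  refine not_reversible_of_param (Equiv.sumCongr (Antichain.equiv ℕ) (Equiv.refl ℕ)) transfer ?_
    (.inl 0) (.inr 0) (by simp) (by simp)
  rintro ((_ | m) | m) ((_ | n) | n) <;> simp

/-- An isolated point moves above the fork's base. The parametrization lists the isolated antichain
first so that `transfer` goes in this direction. -/
theorem not_reversible_F2 : ¬ Reversible F2 := by
  refine not_reversible_of_param
    (R := Unit ⊕ (ℕ ⊕ ℕ))
    ((Equiv.sumCongr (Equiv.refl _) (Equiv.sumComm _ _)).trans <|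
      (Equiv.sumAssoc _ _ _).symm.trans <|
      Equiv.sumCongr ((Equiv.sumCongr (Equiv.refl Unit) (Antichain.equiv ℕ)).trans toLex)
        (Antichain.equiv ℕ)) (Equiv.sumCongr (Equiv.refl _) transfer) ?_
    (.inl ()) (.inr (.inl 0)) (by simp) (by simp)
  rintro (_ | ((_ | m) | m)) (_ | ((_ | n) | n)) <;> simp

/-- The two-element chain, parametrized by `Bool`. -/
def boolEquivChain : Bool ≃ D1 ⊕ₗ D1 where
  toFun b := toLex (cond b (Sum.inr ()) (Sum.inl ()))
  invFun x := (ofLex x).isRight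
  left_inv := by rintro (_ | _) <;> rfl
  right_inv := by rintro (_ | _) <;> rfl

theorem not_reversible_F3 : ¬ Reversible F3 := by
  have hb : ∀ b b' : Bool, boolEquivChain b ≤ boolEquivChain b' ↔ b ≤ b' := by
    rintro (_ | _) (_ | _) <;> simp [boolEquivChain]
  refine not_reversible_of_param
    ((Equiv.sumComm _ _).trans <| Equiv.sumCongr (Antichain.equiv ℕ)
      ((Equiv.prodCongr (Equiv.refl ℕ) boolEquivChain).trans (Equiv.sigmaEquivProd _ _).symm))
    transferPair ?_ (.inr 0) (.inr 1) (by simp) ?_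
  · rintro (⟨m, b⟩ | (_ | _ | m)) (⟨n, b'⟩ | (_ | _ | n)) <;>
      simp [transferPair, sigma_const_le, hb]
  · simp [transferPair, hb]

/-- One antichain point becomes the new bottom of `ω`, and so rises above the rest of the antichain.
-/
theorem not_reversible_F4 : ¬ Reversible F4 := by
  refine not_reversible_of_param
    ((Equiv.sumCongr (Antichain.equiv ℕ) (Equiv.refl ℕ)).trans toLex) transfer ?_
    (.inl 1) (.inl 0) (by simp) (by simp)
  rintro ((_ | m) | m) ((_ | n) | n) <;> simp

/-- The top of `ω^d` becomes the bottom of `ω`, where it lies above the extra point. -/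
theorem not_reversible_F5 : ¬ Reversible F5 := by
  refine not_reversible_of_param (R := Unit ⊕ (ℕ ⊕ ℕ))
    ((Equiv.sumAssoc _ _ _).symm.trans <|
      (Equiv.sumCongr (Equiv.sumCongr (Equiv.refl Unit) OrderDual.toDual) (Equiv.refl ℕ)).trans
        toLex) (Equiv.sumCongr (Equiv.refl _) transfer) ?_
    (.inl ()) (.inr (.inl 0)) (by simp) (by simp)
  rintro (_ | ((_ | m) | m)) (_ | ((_ | n) | n)) <;> simp [-toDual_add, -toDual_zero]

/-- The top two-element level is linearized into the first two elements of `ω`. -/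
theorem not_reversible_F6 : ¬ Reversible F6 := by
  refine not_reversible_of_param
    ((Equiv.sumCongr ((Equiv.prodCongr OrderDual.toDual (Antichain.equiv Bool)).trans toLex)
      (Equiv.refl ℕ)).trans toLex) transferPair.symm ?_
    (.inl (0, false)) (.inl (0, true)) (by simp [Prod.Lex.toLex_le_toLex])
      (by simp [transferPair])
  rintro (⟨_ | m, (_ | _)⟩ | m) (⟨_ | n, (_ | _)⟩ | n) <;>
    simp [transferPair, Prod.Lex.toLex_le_toLex, -toDual_add, -toDual_zero]

/-- The elements of `F7`. -/
def F7.equiv : ℕ ⊕ ℕ ≃ F7 where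
  toFun := Sum.elim F7.d F7.c
  invFun
    | .c i => .inr i
    | .d i => .inl i
  left_inv := by rintro (_ | _) <;> rfl
  right_inv := by rintro (_ | _) <;> rfl

theorem not_reversible_F7 : ¬ Reversible F7 := by
  refine not_reversible_of_param F7.equiv transfer ?_
    (.inl 0) (.inr 0) (by simp [F7.equiv]) (by simp [F7.equiv])
  rintro ((_ | m) | m) ((_ | n) | n) <;> simp [F7.equiv] <;> omega

/-- The elements of `F8`. -/
def F8.equiv : ℤ ⊕ ℤ ≃ F8 where
  toFun := Sum.elim F8.a F8.b
  invFun
    | .a i => .inl i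
    | .b i => .inr i
  left_inv := by rintro (_ | _) <;> rfl
  right_inv := by rintro (_ | _) <;> rfl

/-- Shifting all indices by one gains exactly the relation from index 0 to index 1, since `a 0` and
`b 0` are unrelated but `a 1 < b 1`. -/
theorem not_reversible_F8 : ¬ Reversible F8 := by
  refine not_reversible_of_param F8.equiv
    (Equiv.sumCongr (Equiv.addRight 1) (Equiv.addRight 1)) ?_
    (.inl 0) (.inr 0) (by simp [F8.equiv]) (by simp [F8.equiv])
  rintro (m | m) (n | n) <;> simp [F8.equiv] <;> omega

theorem not_reversible_F (i : Fin 8) : ¬ Reversible (F i) := by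
  fin_cases i
  · exact not_reversible_F1
  · exact not_reversible_F2
  · exact not_reversible_F3
  · exact not_reversible_F4
  · exact not_reversible_F5
  · exact not_reversible_F6
  · exact not_reversible_F7
  · exact not_reversible_F8

theorem not_reversible_F_dual (i : Fin 8) : ¬ Reversible (F i)ᵒᵈ := fun h =>
  not_reversible_F i h.of_dual

theorem hereditarilyReversible_iff {P : Type*} [PartialOrder P] :
    HereditarilyReversible P ↔
      ∀ i : Fin 8, ¬ HasSubsetIso P (F i) ∧ ¬ HasSubsetIso P (F i)ᵒᵈ := by
  constructor
  · intro h i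
    exact ⟨fun ⟨S, ⟨e⟩⟩ => not_reversible_F i ((h S).of_orderIso e),
      fun ⟨S, ⟨e⟩⟩ => not_reversible_F_dual i ((h S).of_orderIso e)⟩
  · intro h S
    by_contra hS
    obtain ⟨i, hi⟩ := (contains_of_not_reversible hS).of_embedding (OrderEmbedding.subtype _)
    rw [← hasSubsetIso_iff, ← hasSubsetIso_iff] at hi
    exact hi.elim (h i).1 (h i).2

theorem F3_selfDual : Nonempty (F3 ≃o F3ᵒᵈ) := by
  refine ⟨⟨(Equiv.sumCongr (Equiv.refl _) (Equiv.sigmaCongrRight fun _ =>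
    (ofLex.trans (Equiv.sumComm _ _)).trans toLex)).trans OrderDual.toDual, ?_⟩⟩
  intro x y
  revert x y
  simp [Antichain.forall, Sigma.forall, sigma_const_le, eq_comm]

theorem F8_selfDual : Nonempty (F8 ≃o F8ᵒᵈ) := by
  refine ⟨⟨(F8.equiv.symm.trans ((Equiv.sumComm _ _).trans F8.equiv)).trans OrderDual.toDual, ?_⟩⟩
  rintro (i | i) (j | j) <;> simp [F8.equiv] <;> omega

/-! ### Isomorphism invariants -/

section Invariants

/-- Some element is comparable to no other element. -/
def HasIsolated (Q : Type*) [PartialOrder Q] : Prop :=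
  ∃ x : Q, ∀ y, x ≤ y ∨ y ≤ x → x = y

/-- There is a chain of three elements. -/
def HasChainThree (Q : Type*) [PartialOrder Q] : Prop :=
  ∃ x y z : Q, x < y ∧ y < z

/-- Some element has two distinct strict upper bounds. -/
def HasFork (Q : Type*) [PartialOrder Q] : Prop :=
  ∃ x y z : Q, x < y ∧ x < z ∧ y ≠ z

/-- Some element is minimal without being isolated. -/
def HasMinBelow (Q : Type*) [PartialOrder Q] : Prop :=
  ∃ x y : Q, x < y ∧ IsMin x

/-- The elements above some element form a chain. -/
def HasChainAbove (Q : Type*) [PartialOrder Q] : Prop :=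
  ∃ x : Q, ∀ y z, x ≤ y → x ≤ z → y ≤ z ∨ z ≤ y

/-- There are minimal elements, and they have a common strict upper bound. -/
def MinBounded (Q : Type*) [PartialOrder Q] : Prop :=
  (∃ x : Q, IsMin x) ∧ ∃ x : Q, ∀ y, IsMin y → y < x

/-- There is exactly one minimal element. -/
def HasUniqueMin (Q : Type*) [PartialOrder Q] : Prop :=
  ∃ x : Q, IsMin x ∧ ∀ y, IsMin y → y = x

/-- There is neither a minimal nor a maximal element. -/
def Unbounded (Q : Type*) [PartialOrder Q] : Prop :=
  ∀ x : Q, ¬ IsMin x ∧ ¬ IsMax x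

variable {Q R : Type*} [PartialOrder Q] [PartialOrder R]

theorem HasIsolated.of_iso (e : Q ≃o R) (h : HasIsolated Q) : HasIsolated R := by
  obtain ⟨x, hx⟩ := h
  refine ⟨e x, e.surjective.forall.2 fun y hy => ?_⟩
  simp only [e.le_iff_le] at hy
  rw [hx y hy]

theorem HasChainThree.of_iso (e : Q ≃o R) (h : HasChainThree Q) : HasChainThree R := by
  obtain ⟨x, y, z, hxy, hyz⟩ := h
  exact ⟨e x, e y, e z, e.strictMono hxy, e.strictMono hyz⟩

theorem HasFork.of_iso (e : Q ≃o R) (h : HasFork Q) : HasFork R := by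
  obtain ⟨x, y, z, hxy, hxz, hne⟩ := h
  exact ⟨e x, e y, e z, e.strictMono hxy, e.strictMono hxz, e.injective.ne hne⟩

theorem HasMinBelow.of_iso (e : Q ≃o R) (h : HasMinBelow Q) : HasMinBelow R := by
  obtain ⟨x, y, hxy, hx⟩ := h
  exact ⟨e x, e y, e.strictMono hxy, e.isMin_apply.2 hx⟩

theorem HasChainAbove.of_iso (e : Q ≃o R) (h : HasChainAbove Q) : HasChainAbove R := by
  obtain ⟨x, hx⟩ := h
  refine ⟨e x, e.surjective.forall₂.2 fun y z hy hz => ?_⟩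
  simp only [e.le_iff_le] at hy hz ⊢
  exact hx y z hy hz

theorem MinBounded.of_iso (e : Q ≃o R) (h : MinBounded Q) : MinBounded R := by
  obtain ⟨⟨m, hm⟩, x, hx⟩ := h
  exact ⟨⟨e m, e.isMin_apply.2 hm⟩, e x, e.surjective.forall.2 fun y hy =>
    e.strictMono (hx y (e.isMin_apply.1 hy))⟩

theorem HasUniqueMin.of_iso (e : Q ≃o R) (h : HasUniqueMin Q) : HasUniqueMin R := by
  obtain ⟨x, hm, hx⟩ := h
  exact ⟨e x, e.isMin_apply.2 hm, e.surjective.forall.2 fun y hy =>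
    congrArg e (hx y (e.isMin_apply.1 hy))⟩

theorem Unbounded.of_iso (e : Q ≃o R) (h : Unbounded Q) : Unbounded R := by
  exact e.surjective.forall.2 fun x => by
    rw [e.isMin_apply, e.isMax_apply]
    exact h x

end Invariants

/-! ### Values of the invariants on the eight posets -/

section Values

theorem sigma_const_lt {ι α : Type*} [Preorder α] {i j : ι} {a b : α} :
    (⟨i, a⟩ : Σ _ : ι, α) < ⟨j, b⟩ ↔ i = j ∧ a < b := by
  simp only [lt_iff_le_not_ge, sigma_const_le]
  constructor
  · rintro ⟨⟨rfl, h⟩, h'⟩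
    exact ⟨rfl, h, fun hba => h' ⟨rfl, hba⟩⟩
  · rintro ⟨rfl, h, h'⟩
    exact ⟨⟨rfl, h⟩, fun hba => h' hba.2⟩

theorem F8.lt_cases {x y : F8} (h : x < y) : ∃ i j, x = .a i ∧ y = .b j := by
  rcases x with i | i <;> rcases y with j | j
  · exact absurd (congrArg F8.a h.le) h.ne
  · exact ⟨i, j, rfl, rfl⟩
  · exact absurd h.le F8.not_b_le_a
  · exact absurd (congrArg F8.b h.le) h.ne

theorem hasIsolated_F1 : HasIsolated F1 := ⟨.inl ⟨0⟩, by simp [Antichain.forall]; intro a; omega⟩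
theorem hasIsolated_F2 : HasIsolated F2 := ⟨.inr ⟨0⟩, by simp [Antichain.forall]; intro a; omega⟩
theorem hasIsolated_F3 : HasIsolated F3 := ⟨.inl ⟨0⟩, by simp [Antichain.forall]; intro a; omega⟩

theorem not_hasIsolated_F4 : ¬ HasIsolated F4 := by
  simp [HasIsolated, Antichain.forall]

theorem not_hasIsolated_F5 : ¬ HasIsolated F5 := by
  simp [HasIsolated]

theorem not_hasIsolated_F6 : ¬ HasIsolated F6 := by
  simp [HasIsolated, Antichain.forall]

theorem not_hasIsolated_F7 : ¬ HasIsolated F7 := by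
  rintro ⟨i | i, h⟩
  · simpa using h (.c (i + 1)) (by simp)
  · simpa using h (.c (i + 1)) (by simp)

theorem not_hasIsolated_F8 : ¬ HasIsolated F8 := by
  rintro ⟨i | i, h⟩
  · simpa using h (.b (i + 1)) (by simp)
  · simpa using h (.a (i + 1)) (by simp)

theorem hasChainThree_F1 : HasChainThree F1 := ⟨.inr 0, .inr 1, .inr 2, by simp, by simp⟩
theorem hasChainThree_F4 : HasChainThree F4 :=
  ⟨toLex (.inr 0), toLex (.inr 1), toLex (.inr 2), by simp, by simp⟩
theorem hasChainThree_F5 : HasChainThree F5 :=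
  ⟨toLex (.inr 0), toLex (.inr 1), toLex (.inr 2), by simp, by simp⟩
theorem hasChainThree_F6 : HasChainThree F6 :=
  ⟨toLex (.inr 0), toLex (.inr 1), toLex (.inr 2), by simp, by simp⟩
theorem hasChainThree_F7 : HasChainThree F7 :=
  ⟨.c 0, .c 1, .c 2, by simp [lt_iff_le_not_ge], by simp [lt_iff_le_not_ge]⟩

theorem not_hasChainThree_F2 : ¬ HasChainThree F2 := by
  simp [HasChainThree]

theorem not_hasChainThree_F3 : ¬ HasChainThree F3 := by
  simp [HasChainThree, Sigma.exists, sigma_const_lt]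

theorem not_hasChainThree_F8 : ¬ HasChainThree F8 := by
  rintro ⟨x, y, z, hxy, hyz⟩
  obtain ⟨_, _, -, rfl⟩ := F8.lt_cases hxy
  obtain ⟨_, _, h, -⟩ := F8.lt_cases hyz
  cases h

theorem hasFork_F2 : HasFork F2 :=
  ⟨.inl (toLex (.inl ())), .inl (toLex (.inr ⟨0⟩)), .inl (toLex (.inr ⟨1⟩)), by simp, by simp,
    by simp⟩

theorem not_hasFork_F2_dual : ¬ HasFork F2ᵒᵈ := by
  simp [HasFork, OrderDual.exists]

theorem not_hasFork_F3 : ¬ HasFork F3 := by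
  simp [HasFork, Sigma.exists, sigma_const_lt]

theorem hasMinBelow_F1 : HasMinBelow F1 := by
  refine ⟨.inr 0, .inr 1, by simp, ?_⟩
  simp [IsMin]

theorem hasMinBelow_F4 : HasMinBelow F4 := by
  refine ⟨toLex (.inl ⟨0⟩), toLex (.inr 0), by simp, ?_⟩
  simp [IsMin, Antichain.forall, eq_comm]

theorem hasMinBelow_F5 : HasMinBelow F5 := by
  refine ⟨toLex (.inl (.inl ())), toLex (.inr 0), by simp, ?_⟩
  simp [IsMin]

theorem hasMinBelow_F7 : HasMinBelow F7 := by
  refine ⟨.c 0, .c 1, by simp [lt_iff_le_not_ge], ?_⟩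
  rintro (i | i) <;> simp

theorem not_hasMinBelow_F1_dual : ¬ HasMinBelow F1ᵒᵈ := by
  simp [HasMinBelow, OrderDual.exists]
  exact fun i _ _ => ⟨i + 1, by omega⟩

theorem not_isMax_F4 (x : F4) : ¬ IsMax x := by
  revert x
  simp

theorem not_isMax_F5 (x : F5) : ¬ IsMax x := by
  revert x
  simp

theorem not_isMax_F6 (x : F6) : ¬ IsMax x := by
  revert x
  simp

theorem not_isMax_F7 (x : F7) : ¬ IsMax x := by
  rw [not_isMax_iff]
  rcases x with i | i <;> exact ⟨.c (i + 1), by simp [lt_iff_le_not_ge]⟩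

theorem not_isMin_F6 (x : F6) : ¬ IsMin x := by
  revert x
  simp only [not_isMin_iff, Lex.forall, Lex.exists, Sum.forall, Sum.exists, Prod.forall,
    Prod.exists, OrderDual.forall, OrderDual.exists]
  refine ⟨fun i b => .inl ⟨i + 1, b, ?_⟩, fun i => .inl ⟨0, ⟨true⟩, by simp⟩⟩
  simp [Prod.Lex.toLex_lt_toLex, -toDual_add]

theorem hasChainAbove_F6 : HasChainAbove F6 := by
  refine ⟨toLex (.inr 0), ?_⟩
  simp [le_total]

/-- Every element of `F6` lies above both points of some two-element level, so no principal down-set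
is a chain. -/
theorem not_hasChainAbove_F6_dual : ¬ HasChainAbove F6ᵒᵈ := by
  rintro ⟨x, hx⟩
  obtain ⟨i, hi⟩ : ∃ i : ℕ, ∀ b : D2,
      toLex (.inl (toLex (OrderDual.toDual i, b))) ≤ (OrderDual.ofDual x : F6) := by
    revert x
    simp only [OrderDual.forall, Lex.forall, Sum.forall, Prod.forall]
    refine ⟨fun i b _ => ⟨i + 1, fun b' => ?_⟩, fun i _ => ⟨0, fun b => ?_⟩⟩
    · simp [Prod.Lex.toLex_le_toLex, -toDual_add]
    · simp
  let w (b : D2) : F6 := toLex (.inl (toLex (OrderDual.toDual i, b)))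
  have h : w ⟨false⟩ ≤ w ⟨true⟩ ∨ w ⟨true⟩ ≤ w ⟨false⟩ :=
    hx (OrderDual.toDual (w ⟨true⟩)) (OrderDual.toDual (w ⟨false⟩)) (hi ⟨true⟩) (hi ⟨false⟩)
  simp [w, Prod.Lex.toLex_le_toLex] at h

theorem minBounded_F4 : MinBounded F4 := by
  refine ⟨⟨toLex (.inl ⟨0⟩), ?_⟩, toLex (.inr 1), ?_⟩
  · simp [IsMin, Antichain.forall, eq_comm]
  · simp [IsMin, Antichain.forall]

/-- Every `d i` is minimal but not below `c i`, so no chain element bounds the minimal elements; the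
minimal element `c 0` rules out every `d i`. -/
theorem not_minBounded_F7 : ¬ MinBounded F7 := by
  rintro ⟨-, i | i, h⟩
  · have := (h (.d i) (by rintro (j | j) <;> simp +contextual)).le
    simp at this
  · have := (h (.c 0) (by rintro (j | j) <;> simp)).le
    simp at this

theorem hasUniqueMin_F5 : HasUniqueMin F5 := by
  refine ⟨toLex (.inl (.inl ())), ?_, ?_⟩
  · simp [IsMin]
  · simp [IsMin]
    exact fun i => ⟨i + 1, by omega⟩

theorem not_hasUniqueMin_F4 : ¬ HasUniqueMin F4 := by
  rintro ⟨x, -, hx⟩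
  have h : ∀ i, toLex (.inl ⟨i⟩) = x := fun i => hx _ (by
    simp [IsMin, Antichain.forall, eq_comm])
  simpa using (h 0).trans (h 1).symm

theorem not_hasUniqueMin_F7 : ¬ HasUniqueMin F7 := by
  rintro ⟨x, -, hx⟩
  have h : ∀ i, .d i = x := fun i => hx _ (by rintro (j | j) <;> simp +contextual)
  simpa using (h 0).trans (h 1).symm

theorem not_exists_isMin_dual {Q : Type*} [PartialOrder Q] (h : ∀ x : Q, ¬ IsMax x) :
    (¬ HasUniqueMin Qᵒᵈ) ∧ (¬ MinBounded Qᵒᵈ) ∧ ¬ HasMinBelow Qᵒᵈ :=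
  ⟨fun ⟨x, hx, _⟩ => h (OrderDual.ofDual x) hx.toDual, fun ⟨⟨_, hx⟩, _⟩ => h _ hx.toDual,
    fun ⟨x, _, _, hx⟩ => h (OrderDual.ofDual x) hx.toDual⟩

end Values

/-! ### Counting the isomorphism classes -/

section Classification

/-- Properties of posets which are invariant under isomorphism and under dualizing. -/
def selfDualProperty (k : Fin 6) (Q : Type*) [PartialOrder Q] : Prop :=
  match k with
  | 0 => HasIsolated Q
  | 1 => HasChainThree Q
  | 2 => HasFork Q ∨ HasFork Qᵒᵈ
  | 3 => Unbounded Q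
  | 4 => HasUniqueMin Q ∨ HasUniqueMin Qᵒᵈ
  | 5 => MinBounded Q ∨ MinBounded Qᵒᵈ

theorem selfDualProperty_of_iso {Q R : Type*} [PartialOrder Q] [PartialOrder R] (e : Q ≃o R)
    (k : Fin 6) (h : selfDualProperty k Q) : selfDualProperty k R := by
  fin_cases k
  · exact HasIsolated.of_iso e h
  · exact HasChainThree.of_iso e h
  · exact Or.imp (.of_iso e) (.of_iso e.dual) h
  · exact Unbounded.of_iso e h
  · exact Or.imp (.of_iso e) (.of_iso e.dual) h
  · exact Or.imp (.of_iso e) (.of_iso e.dual) h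

theorem selfDualProperty_dual {Q : Type*} [PartialOrder Q] (k : Fin 6)
    (h : selfDualProperty k Q) : selfDualProperty k Qᵒᵈ := by
  have e := OrderIso.dualDual Q
  fin_cases k
  · obtain ⟨x, hx⟩ := h
    exact ⟨OrderDual.toDual x, fun y hy => hx _ hy.symm⟩
  · obtain ⟨x, y, z, hxy, hyz⟩ := h
    exact ⟨OrderDual.toDual z, OrderDual.toDual y, OrderDual.toDual x, hyz, hxy⟩
  · exact Or.symm (Or.imp (.of_iso e) id h)
  · exact fun x => ⟨fun hx => (h _).2 hx.toDual, fun hx => (h _).1 hx.toDual⟩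
  · exact Or.symm (Or.imp (.of_iso e) id h)
  · exact Or.symm (Or.imp (.of_iso e) id h)

theorem selfDualProperty_dual_iff {Q : Type*} [PartialOrder Q] (k : Fin 6) :
    selfDualProperty k Qᵒᵈ ↔ selfDualProperty k Q :=
  ⟨fun h => selfDualProperty_of_iso (OrderIso.dualDual Q).symm k (selfDualProperty_dual k h),
    selfDualProperty_dual k⟩

theorem hasIsolated_F_iff (i : Fin 8) : selfDualProperty 0 (F i) ↔ i ≤ 2 := by
  fin_cases i
  · exact iff_of_true hasIsolated_F1 (by decide)
  · exact iff_of_true hasIsolated_F2 (by decide)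
  · exact iff_of_true hasIsolated_F3 (by decide)
  · exact iff_of_false not_hasIsolated_F4 (by decide)
  · exact iff_of_false not_hasIsolated_F5 (by decide)
  · exact iff_of_false not_hasIsolated_F6 (by decide)
  · exact iff_of_false not_hasIsolated_F7 (by decide)
  · exact iff_of_false not_hasIsolated_F8 (by decide)

theorem hasChainThree_F_iff (i : Fin 8) : selfDualProperty 1 (F i) ↔ i ≠ 1 ∧ i ≠ 2 ∧ i ≠ 7 := by
  fin_cases i
  · exact iff_of_true hasChainThree_F1 (by decide)
  · exact iff_of_false not_hasChainThree_F2 (by decide)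
  · exact iff_of_false not_hasChainThree_F3 (by decide)
  · exact iff_of_true hasChainThree_F4 (by decide)
  · exact iff_of_true hasChainThree_F5 (by decide)
  · exact iff_of_true hasChainThree_F6 (by decide)
  · exact iff_of_true hasChainThree_F7 (by decide)
  · exact iff_of_false not_hasChainThree_F8 (by decide)

theorem hasFork_F_iff {i : Fin 8} (hi : i = 1 ∨ i = 2) : selfDualProperty 2 (F i) ↔ i = 1 := by
  rcases hi with rfl | rfl
  · exact iff_of_true (.inl hasFork_F2) rfl
  · refine iff_of_false (not_or.2 ⟨not_hasFork_F3, fun h => ?_⟩) (by decide)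
    obtain ⟨e⟩ := F3_selfDual
    exact not_hasFork_F3 (h.of_iso e.symm)

theorem unbounded_F_iff {i : Fin 8} (hi : 3 ≤ i ∧ i ≤ 6) :
    selfDualProperty 3 (F i) ↔ i = 5 := by
  obtain rfl | rfl | rfl | rfl : i = 3 ∨ i = 4 ∨ i = 5 ∨ i = 6 := by omega
  · obtain ⟨x, -, -, hx⟩ := hasMinBelow_F4
    exact iff_of_false (fun h => (h x).1 hx) (by decide)
  · obtain ⟨x, -, -, hx⟩ := hasMinBelow_F5
    exact iff_of_false (fun h => (h x).1 hx) (by decide)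
  · exact iff_of_true (fun x => ⟨not_isMin_F6 x, not_isMax_F6 x⟩) rfl
  · obtain ⟨x, -, -, hx⟩ := hasMinBelow_F7
    exact iff_of_false (fun h => (h x).1 hx) (by decide)

theorem hasUniqueMin_F_iff {i : Fin 8} (hi : i = 3 ∨ i = 4 ∨ i = 6) :
    selfDualProperty 4 (F i) ↔ i = 4 := by
  rcases hi with rfl | rfl | rfl
  · exact iff_of_false (not_or.2 ⟨not_hasUniqueMin_F4, (not_exists_isMin_dual not_isMax_F4).1⟩)
      (by decide)
  · exact iff_of_true (.inl hasUniqueMin_F5) rfl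
  · exact iff_of_false (not_or.2 ⟨not_hasUniqueMin_F7, (not_exists_isMin_dual not_isMax_F7).1⟩)
      (by decide)

theorem minBounded_F_iff {i : Fin 8} (hi : i = 3 ∨ i = 6) :
    selfDualProperty 5 (F i) ↔ i = 3 := by
  rcases hi with rfl | rfl
  · exact iff_of_true (.inl minBounded_F4) rfl
  · exact iff_of_false (not_or.2 ⟨not_minBounded_F7, (not_exists_isMin_dual not_isMax_F7).2.1⟩)
      (by decide)

theorem selfDualProperty_forbidden (k : Fin 6) (p : Fin 8 × Bool) :
    selfDualProperty k (forbidden p) ↔ selfDualProperty k (F p.1) := by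
  obtain ⟨i, _ | _⟩ := p
  · exact Iff.rfl
  · exact selfDualProperty_dual_iff (Q := F i) k

/-- Isolated points and three-chains sort the indices into `F1`, `F2`/`F3`, `F4`–`F7` and `F8`.
Forks split the second group; in the third, absence of extremal elements singles out `F6`, a unique
extremal element on one side `F5`, and a common bound of the extremal elements separates `F4` from
`F7`. -/
theorem eq_of_forbidden_iso {p q : Fin 8 × Bool} (e : forbidden p ≃o forbidden q) :
    p.1 = q.1 := by
  have h : ∀ k, selfDualProperty k (F p.1) ↔ selfDualProperty k (F q.1) := fun k => by
    rw [← selfDualProperty_forbidden, ← selfDualProperty_forbidden]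
    exact ⟨selfDualProperty_of_iso e k, selfDualProperty_of_iso e.symm k⟩
  generalize p.1 = i at h
  generalize q.1 = j at h
  have h0 := h 0
  have h1 := h 1
  rw [hasIsolated_F_iff, hasIsolated_F_iff] at h0
  rw [hasChainThree_F_iff, hasChainThree_F_iff] at h1
  have h2 : i = 1 ∨ i = 2 → j = 1 ∨ j = 2 → (i = 1 ↔ j = 1) := fun hi hj => by
    rw [← hasFork_F_iff hi, ← hasFork_F_iff hj, h]
  have h3 : 3 ≤ i ∧ i ≤ 6 → 3 ≤ j ∧ j ≤ 6 → (i = 5 ↔ j = 5) := fun hi hj => by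
    rw [← unbounded_F_iff hi, ← unbounded_F_iff hj, h]
  have h4 : i = 3 ∨ i = 4 ∨ i = 6 → j = 3 ∨ j = 4 ∨ j = 6 → (i = 4 ↔ j = 4) := fun hi hj => by
    rw [← hasUniqueMin_F_iff hi, ← hasUniqueMin_F_iff hj, h]
  have h5 : i = 3 ∨ i = 6 → j = 3 ∨ j = 6 → (i = 3 ↔ j = 3) := fun hi hj => by
    rw [← minBounded_F_iff hi, ← minBounded_F_iff hj, h]
  clear h
  omega

/-- In each other case a one-sided invariant distinguishes the poset from its dual: a non-isolated
minimal element for `F1`, `F4`, `F5`, `F7`, a fork for `F2`, a principal up-set that is a chain for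
`F6`. -/
theorem eq_of_selfDual {i : Fin 8} (e : F i ≃o (F i)ᵒᵈ) : i = 2 ∨ i = 7 := by
  fin_cases i
  · exact (not_hasMinBelow_F1_dual (hasMinBelow_F1.of_iso e)).elim
  · exact (not_hasFork_F2_dual (hasFork_F2.of_iso e)).elim
  · exact .inl rfl
  · exact ((not_exists_isMin_dual not_isMax_F4).2.2 (hasMinBelow_F4.of_iso e)).elim
  · exact ((not_exists_isMin_dual not_isMax_F5).2.2 (hasMinBelow_F5.of_iso e)).elim
  · exact (not_hasChainAbove_F6_dual (hasChainAbove_F6.of_iso e)).elim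
  · exact ((not_exists_isMin_dual not_isMax_F7).2.2 (hasMinBelow_F7.of_iso e)).elim
  · exact .inr rfl

/-- A representative of the isomorphism class of `forbidden p`. -/
def representative (p : Fin 8 × Bool) : Fin 8 × Bool :=
  if p.1 = 2 ∨ p.1 = 7 then (p.1, false) else p

theorem isoSetoid_eq_ker : isoSetoid = Setoid.ker representative := by
  ext ⟨i, b⟩ ⟨j, b'⟩
  rw [Setoid.ker_def]
  constructor
  · rintro ⟨e⟩
    obtain rfl : i = j := eq_of_forbidden_iso e
    by_cases hi : i = 2 ∨ i = 7
    · simp [representative, hi]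
    · suffices b = b' by rw [this]
      rcases b with _ | _ <;> rcases b' with _ | _
      · rfl
      · exact absurd (eq_of_selfDual e) hi
      · exact absurd (eq_of_selfDual e.symm) hi
      · rfl
  · intro h
    have key : (i, b) = (j, b') ∨ i = j ∧ (i = 2 ∨ i = 7) := by
      revert i b j b'
      decide
    rcases key with h | ⟨rfl, hi⟩
    · rw [h]
    · have hd : Nonempty (F i ≃o (F i)ᵒᵈ) := by
        rcases hi with rfl | rfl
        · exact F3_selfDual
        · exact F8_selfDual
      obtain ⟨e⟩ := hd
      rcases b with _ | _ <;> rcases b' with _ | _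
      · exact ⟨OrderIso.refl _⟩
      · exact ⟨e⟩
      · exact ⟨e.symm⟩
      · exact ⟨OrderIso.refl _⟩

theorem card_quotient_isoSetoid : Nat.card (Quotient isoSetoid) = 14 := by
  rw [isoSetoid_eq_ker, Nat.card_congr (Setoid.quotientKerEquivRange representative),
    Nat.card_eq_fintype_card]
  decide

end Classification

end RevPoset

theorem mainTheorem2 (P : Type*) [PartialOrder P] :
    -- the characterization
    (HereditarilyReversible P ↔
      ∀ i : Fin 8, ¬ HasSubsetIso P (F i) ∧ ¬ HasSubsetIso P (F i)ᵒᵈ) ∧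
    -- none of the forbidden posets is reversible
    (∀ i : Fin 8, ¬ Reversible (F i) ∧ ¬ Reversible (F i)ᵒᵈ) ∧
    -- two of them are self-dual, and up to isomorphism there are 14 in total
    Nonempty (F3 ≃o F3ᵒᵈ) ∧ Nonempty (F8 ≃o F8ᵒᵈ) ∧
    Nat.card (Quotient isoSetoid) = 14 := by
  exact ⟨hereditarilyReversible_iff, fun i => ⟨not_reversible_F i, not_reversible_F_dual i⟩,
    F3_selfDual, F8_selfDual, card_quotient_isoSetoid⟩
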